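/- Let $p$ be a prime, $\Gamma$ a finite abelian group, and $e$ a primitive idempotent of $\mathbb{Q}_p[\Gamma]$. Let $e\mathbb{Z}_p[\Gamma]=\{ex \mid x\in\mathbb{Z}_p[\Gamma]\}\subset\mathbb{Q}_p[\Gamma]$, which is a commutative local ring with identity $e$; let $\mathfrak m_e$ be its maximal ideal and $A=e\mathbb{Z}_p[\Gamma]/\mathfrak m_e$ its residue field, which is finite. Let $\mathcal P$ be the set of isomorphism classes of finite $e\mathbb{Z}_p[\Gamma]$-modules, with the topology generated by the sets $$U_{M,I}=\{X\in\mathcal P \mid X\otimes_{e\mathbb{Z}_p[\Gamma]}e\mathbb{Z}_p[\Gamma]/I\simeq M\}$$ for $M\in\mathcal P$ and $I$ a nonzero ideal of $e\mathbb{Z}_p[\Gamma]$, and with its Borel $\sigma$-algebra. Then there is a unique probability measure $\mu$ on $\mathcal P$ such that $$\int_{X\in\mathcal P}\#\mathrm{Sur}_{e\mathbb{Z}_p[\Gamma]}(X,M)\,d\mu=\frac1{|M|}$$ for every finite $e\mathbb{Z}_p[\Gamma]$-module $M$, where $\mathrm{Sur}_{e\mathbb{Z}_p[\Gamma]}(X,M)$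 is the set of surjective $e\mathbb{Z}_p[\Gamma]$-module homomorphisms $X\to M$. It is given by $$\mu(\{M\})=\frac{1}{|\mathrm{Aut}_{e\mathbb{Z}_p[\Gamma]}(M)|\,|M|}\prod_{i=2}^{\infty}\left(1-|A|^{-i}\right)\qquad\text{for every } M\in\mathcal P.$$ -/

import Mathlib

open scoped TensorProduct ENNReal

universe u v

noncomputable section

/-- A primitive idempotent of a ring: a nonzero idempotent which is not the sum of two nonzero
orthogonal idempotents. -/
structure IsPrimitiveIdempotent {S : Type*} [Ring S] (e : S) : Prop where
  idem : IsIdempotentElem e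
  ne_zero : e ≠ 0
  indecomposable : ∀ f g : S, IsIdempotentElem f → IsIdempotentElem g →
    f * g = 0 → g * f = 0 → f + g = e → f = 0 ∨ g = 0

section IdempotentRing

variable (p : ℕ) [Fact p.Prime] {Γ : Type u} [CommGroup Γ]

/-- For an idempotent `e` of `ℚ_p[Γ]`, the ring `e ℤ_p[Γ] = {e x | x ∈ ℤ_p[Γ]} ⊆ ℚ_p[Γ]`. It is a
subring of the corner ring `e ℚ_p[Γ] e = e ℚ_p[Γ]`, whose identity element is `e`. -/
def idempotentSubring {e : MonoidAlgebra ℚ_[p] Γ} (he : IsIdempotentElem e) :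
    Subring he.Corner where
  carrier := {y | ∃ x : MonoidAlgebra ℤ_[p] Γ,
    (y.1 : MonoidAlgebra ℚ_[p] Γ) =
      e * MonoidAlgebra.mapRingHom Γ (algebraMap ℤ_[p] ℚ_[p]) x}
  mul_mem' := by
    rintro a b ⟨x, hx⟩ ⟨y, hy⟩
    refine ⟨x * y, ?_⟩
    change a.1 * b.1 = _
    rw [hx, hy, map_mul, mul_mul_mul_comm, he.eq]
  one_mem' := ⟨1, by rw [map_one, mul_one]; rfl⟩
  add_mem' := by
    rintro a b ⟨x, hx⟩ ⟨y, hy⟩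
    refine ⟨x + y, ?_⟩
    change a.1 + b.1 = _
    rw [hx, hy, map_add, mul_add]
  zero_mem' := ⟨0, by rw [map_zero, mul_zero]; rfl⟩
  neg_mem' := by
    rintro a ⟨x, hx⟩
    refine ⟨-x, ?_⟩
    change -a.1 = _
    rw [hx, map_neg, mul_neg]

end IdempotentRing

section FiniteModules

variable (R : Type u) [CommRing R]

/-- Two finite `R`-modules are equivalent when they are isomorphic. -/
def finiteModuleSetoid : Setoid {M : ModuleCat.{v} R // Finite M} where
  r M N := Nonempty (M.1 ≃ₗ[R] N.1)
  iseqv :=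
    { refl := fun _ => ⟨LinearEquiv.refl R _⟩
      symm := fun ⟨f⟩ => ⟨f.symm⟩
      trans := fun ⟨f⟩ ⟨g⟩ => ⟨f.trans g⟩ }

/-- The set of isomorphism classes of finite `R`-modules. -/
def FiniteModuleClass : Type (max u (v + 1)) := Quotient (finiteModuleSetoid.{u, v} R)

namespace FiniteModuleClass

/-- The isomorphism class of a finite `R`-module. -/
def mk (M : Type v) [AddCommGroup M] [Module R M] [Finite M] : FiniteModuleClass.{u, v} R :=
  Quotient.mk (finiteModuleSetoid.{u, v} R) ⟨ModuleCat.of R M, ‹Finite M›⟩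

/-- The set of classes of those finite `R`-modules `X` for which `X ⊗ R/I` is isomorphic to `M`. -/
def basicOpen (M : Type v) [AddCommGroup M] [Module R M] (I : Ideal R) :
    Set (FiniteModuleClass.{u, v} R) :=
  {c | ∃ X : {X : ModuleCat.{v} R // Finite X}, Quotient.mk (finiteModuleSetoid.{u, v} R) X = c ∧
    Nonempty ((X.1 ⊗[R] (R ⧸ I)) ≃ₗ[R] M)}

/-- The topology generated by the sets `basicOpen R M I`, for `M` a finite `R`-module and `I` a
nonzero ideal. -/
instance : TopologicalSpace (FiniteModuleClass.{u, v} R) :=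
  TopologicalSpace.generateFrom
    {U | ∃ (M : {M : ModuleCat.{v} R // Finite M}) (I : Ideal R), I ≠ ⊥ ∧ U = basicOpen R M.1 I}

/-- Measures on the set of isomorphism classes are Borel measures. -/
instance : MeasurableSpace (FiniteModuleClass.{u, v} R) := borel _

instance : BorelSpace (FiniteModuleClass.{u, v} R) := ⟨rfl⟩

variable {R}

/-- The number of surjective `R`-linear maps from a module in the class `X` to `M`. -/
def numSur (X : FiniteModuleClass.{u, v} R) (M : Type v) [AddCommGroup M] [Module R M] : ℕ :=
  Quotient.lift
    (fun N : {N : ModuleCat.{v} R // Finite N} =>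
      Nat.card {f : N.1 →ₗ[R] M // Function.Surjective f})
    (by
      rintro N N' ⟨g⟩
      exact Nat.card_congr
        { toFun := fun f => ⟨f.1 ∘ₗ g.symm.toLinearMap, f.2.comp g.symm.surjective⟩
          invFun := fun f => ⟨f.1 ∘ₗ g.toLinearMap, f.2.comp g.surjective⟩
          left_inv := fun f => by ext x; simp
          right_inv := fun f => by ext x; simp })
    X

end FiniteModuleClass

/-- The measure `μ` on isomorphism classes of finite `R`-modules has, for every finite `R`-module
`M`, the `M`-moment `∫ #Sur(X, M) dμ(X)` equal to `1 / |M|`. -/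
def HasInverseCardMoments
    (μ : MeasureTheory.Measure (FiniteModuleClass.{u, v} R)) : Prop :=
  ∀ (M : Type v) [AddCommGroup M] [Module R M] [Finite M],
    ∫⁻ X, (X.numSur M : ℝ≥0∞) ∂μ = ((Nat.card M : ℕ) : ℝ≥0∞)⁻¹

end FiniteModules

end

/-! The ring R = eℤ_p[Γ] is a discrete valuation ring with finite residue field, of order q say, and
the rest of the argument uses only this. R is a domain because e is primitive, local because it is
integral over ℤ_p, and its maximal ideal is principal because R is generated over ℤ_p by a root of
unity (`PadicInt.isDiscreteValuationRing_of_surjective`).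

Existence: let w(X) = 1/(|Aut X| |X|). Summing #Sur(R^n/L, M) |R^n/L|^(-n-1) over the submodules L
of finite index in R^n, once by the class of R^n/L and once by the surjection R^n → M whose kernel
contains L, gives a zeta value of R^n. That value is ∏_{i=2}^{n+1} (1 - q^(-i))⁻¹
(`latticeZeta_pi`). As n → ∞, the proportion of n-tuples generating a given finite module increases
to 1, so ∑ #Sur(X, M) w(X) = 1/(P|M|) with P = ∏_{i≥2} (1 - q^(-i)) (`tsum_numSur_div_autMulCard`).
Hence P·w has the required moments, and M = 0 shows that its total mass is 1.

Uniqueness: the set of classes is countable with open points, so a measure is a family of masses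
solving a linear system. Its diagonal part dominates: relative to w the off-diagonal part has size z
= 1/P - 1, and z < 1 because P ≥ 9/16. Two solutions therefore differ by at most z^k w for every k
(`eq_of_tsum_numSur_eq`). -/

/-! ### Integral domains over ℤ_p -/

/-- Integral extensions reflect units, and `x` is invertible in the integral closure of `S` in `K`.
-/
theorem isUnit_of_isIntegral_algebraMap_inv {S K : Type*} [CommRing S] [IsDomain S]
    [Field K] [Algebra S K] [IsFractionRing S K] {x : S} (hx : x ≠ 0)
    (hint : IsIntegral S (algebraMap S K x)⁻¹) : IsUnit x := by
  have : FaithfulSMul S (integralClosure S K) :=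
    (faithfulSMul_iff_algebraMap_injective _ _).mpr fun a b h =>
      IsFractionRing.injective S K (congrArg Subtype.val h)
  refine (isUnit_map_iff (algebraMap S (integralClosure S K)) x).mp ?_
  refine IsUnit.of_mul_eq_one ⟨_, hint⟩ (Subtype.ext ?_)
  refine mul_inv_cancel₀ ?_
  exact fun h => hx (IsFractionRing.injective S K (h.trans (map_zero _).symm))

/-- The spectral norm on `K` is multiplicative and nonarchimedean, and its unit ball consists of the
elements integral over ℤ_p. So the units of `S` are its elements of norm 1, and the nonunits, of
norm less than 1, are closed under addition. -/
theorem PadicInt.isLocalRing_of_isFractionRing {p : ℕ} [Fact p.Prime] {S K : Type*} [CommRing S]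
    [IsDomain S] [Algebra ℤ_[p] S] [Algebra.IsIntegral ℤ_[p] S] [Field K] [Algebra S K]
    [IsFractionRing S K] [Algebra ℤ_[p] K] [IsScalarTower ℤ_[p] S K] [Algebra ℚ_[p] K]
    [IsScalarTower ℤ_[p] ℚ_[p] K] : IsLocalRing S := by
  have : Algebra.IsAlgebraic ℤ_[p] K :=
    (IsFractionRing.comap_isAlgebraic_iff (A := ℤ_[p]) (K := ℚ_[p]) (C := K)).mpr
      (by
        have : FaithfulSMul ℤ_[p] K := (faithfulSMul_iff_algebraMap_injective _ _).mpr (by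
          rw [IsScalarTower.algebraMap_eq ℤ_[p] ℚ_[p] K]
          exact (algebraMap ℚ_[p] K).injective.comp (IsFractionRing.injective ℤ_[p] ℚ_[p]))
        exact IsFractionRing.comap_isAlgebraic_iff.mp
          ((IsFractionRing.isAlgebraic_iff' ℤ_[p] S K).mp inferInstance))
  have : Algebra.IsAlgebraic ℚ_[p] K :=
    (IsFractionRing.comap_isAlgebraic_iff (A := ℤ_[p]) (K := ℚ_[p]) (C := K)).mp inferInstance
  have norm_le_of_isIntegral : ∀ x : K, IsIntegral ℤ_[p] x → spectralNorm ℚ_[p] K x ≤ 1 := by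
    intro x hx
    rw [spectralNorm, spectralValue_le_one_iff (minpoly.monic hx.tower_top),
      minpoly.isIntegrallyClosed_eq_field_fractions' ℚ_[p] hx]
    intro n
    rw [Polynomial.coeff_map]
    exact PadicInt.norm_le_one _
  have isIntegral_of_norm_le : ∀ x : K, spectralNorm ℚ_[p] K x ≤ 1 → IsIntegral ℤ_[p] x := by
    intro x hx
    have hxi : IsIntegral ℚ_[p] x := Algebra.IsIntegral.isIntegral x
    rw [spectralNorm, spectralValue_le_one_iff (minpoly.monic hxi)] at hx
    have hlift : minpoly ℚ_[p] x ∈ Polynomial.lifts (algebraMap ℤ_[p] ℚ_[p]) := by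
      rw [Polynomial.lifts_iff_coeff_lifts]
      exact fun n => ⟨⟨_, hx n⟩, rfl⟩
    obtain ⟨f, hf, -, hmonic⟩ := Polynomial.lifts_and_degree_eq_and_monic hlift (minpoly.monic hxi)
    refine ⟨f, hmonic, ?_⟩
    have := minpoly.aeval ℚ_[p] x
    rwa [← hf, Polynomial.aeval_map_algebraMap] at this
  have hle : ∀ y : S, spectralNorm ℚ_[p] K (algebraMap S K y) ≤ 1 := fun y =>
    norm_le_of_isIntegral _ ((Algebra.IsIntegral.isIntegral y).algebraMap)
  have isUnit_iff : ∀ x : S, IsUnit x ↔ spectralNorm ℚ_[p] K (algebraMap S K x) = 1 := by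
    intro x
    constructor
    · rintro hx
      obtain ⟨y, hy⟩ := hx.exists_right_inv
      have h1 : spectralAlgNorm ℚ_[p] K (algebraMap S K x * algebraMap S K y) = 1 := by
        rw [← map_mul, hy, map_one, spectralAlgNorm_one]
      rw [spectralAlgNorm_mul, spectralAlgNorm_def, spectralAlgNorm_def] at h1
      nlinarith [hle x, hle y, spectralNorm_nonneg (K := ℚ_[p]) (algebraMap S K x),
        spectralNorm_nonneg (K := ℚ_[p]) (algebraMap S K y)]
    · intro hx
      have hx0 : algebraMap S K x ≠ 0 := by
        intro h
        rw [h, spectralNorm_zero] at hx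
        exact zero_ne_one hx
      have h1 : spectralAlgNorm ℚ_[p] K (algebraMap S K x * (algebraMap S K x)⁻¹) = 1 := by
        rw [mul_inv_cancel₀ hx0, spectralAlgNorm_one]
      rw [spectralAlgNorm_mul, spectralAlgNorm_def, hx, one_mul, spectralAlgNorm_def] at h1
      exact isUnit_of_isIntegral_algebraMap_inv
        (fun h => hx0 (by rw [h, map_zero])) (isIntegral_of_norm_le _ h1.le).tower_top
  refine IsLocalRing.of_nonunits_add fun a b ha hb => ?_
  rw [mem_nonunits_iff, isUnit_iff] at *
  rw [map_add]
  exact ((isNonarchimedean_spectralNorm _ _).trans_lt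
    (max_lt (lt_of_le_of_ne (hle a) ha) (lt_of_le_of_ne (hle b) hb))).ne

theorem PadicInt.isLocalRing_of_isIntegral {p : ℕ} [Fact p.Prime] {S : Type*} [CommRing S]
    [IsDomain S] [Algebra ℤ_[p] S] [Algebra.IsIntegral ℤ_[p] S]
    (hinj : Function.Injective (algebraMap ℤ_[p] S)) : IsLocalRing S := by
  let K := FractionRing S
  have hinjK : Function.Injective (algebraMap ℤ_[p] K) := by
    rw [IsScalarTower.algebraMap_eq ℤ_[p] S K]
    exact (IsFractionRing.injective S K).comp hinj
  let : Algebra ℚ_[p] K := (IsFractionRing.lift hinjK : ℚ_[p] →+* K).toAlgebra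
  have : IsScalarTower ℤ_[p] ℚ_[p] K := IsScalarTower.of_algebraMap_eq fun x =>
    (IsFractionRing.lift_algebraMap hinjK x).symm
  exact PadicInt.isLocalRing_of_isFractionRing (p := p) (K := K)

/-- A domain of characteristic zero generated over `ℤ_p` by a finite commutative group of units is
a discrete valuation ring with finite residue field. -/
theorem PadicInt.isDiscreteValuationRing_of_surjective {p : ℕ} [hp : Fact p.Prime] {Γ : Type*}
    [CommGroup Γ] [Finite Γ] {S : Type*} [CommRing S] [IsDomain S]
    (φ : MonoidAlgebra ℤ_[p] Γ →+* S) (hφ : Function.Surjective φ) (hpS : (p : S) ≠ 0) :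
    ∃ _ : IsLocalRing S, IsDiscreteValuationRing S ∧ Finite (IsLocalRing.ResidueField S) := by
  let C : ℤ_[p] →+* MonoidAlgebra ℤ_[p] Γ := MonoidAlgebra.singleOneRingHom
  let : Algebra ℤ_[p] S := (φ.comp C).toAlgebra
  let φ' : MonoidAlgebra ℤ_[p] Γ →ₐ[ℤ_[p]] S := { φ with commutes' := fun x => rfl }
  have : Module.Finite ℤ_[p] (MonoidAlgebra ℤ_[p] Γ) := inferInstance
  have : Module.Finite ℤ_[p] S := Module.Finite.of_surjective φ'.toLinearMap hφ
  have : IsNoetherianRing S := isNoetherian_of_tower ℤ_[p] inferInstance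
  have hinj : Function.Injective (algebraMap ℤ_[p] S) := by
    rw [injective_iff_map_eq_zero]
    intro x hx
    by_contra hx0
    obtain ⟨n, u, rfl⟩ : ∃ (n : ℕ) (u : ℤ_[p]ˣ), x = u * (p : ℤ_[p]) ^ n :=
      ⟨_, _, PadicInt.unitCoeff_spec hx0⟩
    rw [map_mul, map_pow, map_natCast] at hx
    exact mul_ne_zero ((u.isUnit.map (algebraMap ℤ_[p] S)).ne_zero) (pow_ne_zero n hpS) hx
  have hloc : IsLocalRing S := PadicInt.isLocalRing_of_isIntegral hinj
  let 𝔪 := IsLocalRing.maximalIdeal S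
  have : FaithfulSMul ℤ_[p] S := (faithfulSMul_iff_algebraMap_injective _ _).mpr hinj
  have hpm : (p : S) ∈ 𝔪 := by
    rw [IsLocalRing.mem_maximalIdeal, mem_nonunits_iff, ← map_natCast (algebraMap ℤ_[p] S),
      isUnit_map_iff]
    exact PadicInt.p_nonunit
  let ψ : Γ →* S := φ.toMonoidHom.comp (MonoidAlgebra.of ℤ_[p] Γ)
  have : Finite ψ.toHomUnits.range := Set.finite_range ψ.toHomUnits
  -- A finite group of units of a domain is cyclic, so `Γ` acts through powers of one root of unity,
  -- of order p^k m with p ∤ m.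
  obtain ⟨ζ, hζ⟩ := IsCyclic.exists_monoid_generator (α := ψ.toHomUnits.range)
  obtain ⟨k, m, hm, hn⟩ := Nat.exists_eq_pow_mul_and_not_dvd
    (orderOf_pos ζ).ne' p hp.out.ne_one
  let z : S := ((ζ : Sˣ) : S)
  have hz : orderOf z = orderOf ζ := by
    rw [← Subgroup.orderOf_coe ζ, ← orderOf_units]
  have hψ : ∀ g, ∃ i : ℕ, ψ g = z ^ i := by
    intro g
    obtain ⟨i, hi⟩ := hζ ⟨ψ.toHomUnits g, g, rfl⟩
    refine ⟨i, ?_⟩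
    have := congrArg (fun w : ψ.toHomUnits.range => ((w : Sˣ) : S)) hi
    simpa [z] using this.symm
  have hmpos : 0 < m := Nat.pos_of_ne_zero (by rintro rfl; simp at hm)
  -- By Euler, p^t ≡ 1 mod m, so x ↦ x^(p^t) fixes the class of `z` modulo `J`.
  let t := m.totient
  let J : Ideal S := Ideal.span {z ^ m - 1, (p : S)}
  have hJz : z ^ m - 1 ∈ J := Ideal.subset_span (by simp)
  have hJp : (p : S) ∈ J := Ideal.subset_span (by simp)
  have hzn : (z ^ m) ^ p ^ k = 1 := by
    rw [← pow_mul, mul_comm, ← hn, ← hz, pow_orderOf_eq_one]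
  have charP_quotient : ∀ I : Ideal S, I ≤ 𝔪 → (p : S) ∈ I → CharP (S ⧸ I) p := by
    intro I hI hpI
    have : Nontrivial (S ⧸ I) := Ideal.Quotient.nontrivial_iff.mpr
      fun h => (IsLocalRing.maximalIdeal.isMaximal S).ne_top (top_le_iff.mp (h ▸ hI))
    rw [CharP.charP_iff_prime_eq_zero hp.out, ← map_natCast (Ideal.Quotient.mk I)]
    exact Ideal.Quotient.eq_zero_iff_mem.mpr hpI
  -- In characteristic p, (z^m - 1)^(p^k) = z^(m p^k) - 1 = 0.
  have hzm : z ^ m - 1 ∈ 𝔪 := by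
    have : CharP (S ⧸ 𝔪) p := charP_quotient 𝔪 le_rfl hpm
    rw [← Ideal.Quotient.eq_zero_iff_mem]
    refine eq_zero_of_pow_eq_zero (n := p ^ k) ?_
    rw [map_sub, sub_pow_char_pow, ← map_pow, ← map_pow, hzn, one_pow, sub_self]
  have hJm : J ≤ 𝔪 := Ideal.span_le.mpr (by
    rintro x (rfl | rfl)
    exacts [hzm, hpm])
  -- The iterated Frobenius of S/J is a ring homomorphism; it fixes the images of ℤ_p (which are
  -- classes of integers) and of `Γ`, and these generate.
  have hfrob : ∀ x : S, x ^ p ^ t - x ∈ J := by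
    have : CharP (S ⧸ J) p := charP_quotient J hJm hJp
    have : ExpChar (S ⧸ J) p := ExpChar.prime hp.out
    let q := Ideal.Quotient.mk J
    have hcoeff : ∀ a : ℤ_[p], q (algebraMap ℤ_[p] S a) ^ p ^ t = q (algebraMap ℤ_[p] S a) := by
      intro a
      obtain ⟨n, -, hn⟩ := PadicInt.exists_mem_range a
      rw [PadicInt.maximalIdeal_eq_span_p, Ideal.mem_span_singleton] at hn
      obtain ⟨b, hb⟩ := hn
      have hqa : q (algebraMap ℤ_[p] S a) = n := by
        rw [sub_eq_iff_eq_add.mp hb, map_add, map_mul, map_natCast, map_natCast, map_add, map_mul,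
          map_natCast, map_natCast, CharP.cast_eq_zero, zero_mul, zero_add]
      rw [hqa]
      exact map_natCast (iterateFrobenius (S ⧸ J) p t) n
    have hgroup : ∀ g : Γ, q (ψ g) ^ p ^ t = q (ψ g) := by
      intro g
      obtain ⟨i, hi⟩ := hψ g
      have h1 : q z ^ m = 1 := by
        rw [← sub_eq_zero, ← map_pow, ← map_one q, ← map_sub]
        exact Ideal.Quotient.eq_zero_iff_mem.mpr hJz
      have h2 : q z ^ p ^ t = q z := by
        have h3 : p ^ t ≡ 1 [MOD m] :=
          Nat.ModEq.pow_totient ((Nat.Prime.coprime_iff_not_dvd hp.out).mpr hm)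
        rw [← pow_mod_orderOf, h3.of_dvd (orderOf_dvd_of_pow_eq_one h1), pow_mod_orderOf, pow_one]
      rw [hi, map_pow, ← pow_mul, mul_comm, pow_mul, h2]
    have hlocus : ∀ x : MonoidAlgebra ℤ_[p] Γ,
        iterateFrobenius (S ⧸ J) p t (q (φ x)) = q (φ x) := by
      intro x
      induction x using MonoidAlgebra.induction_on with
      | of g => exact hgroup g
      | add x y hx hy => rw [map_add, map_add, map_add, hx, hy]
      | smul a x hx =>
        rw [show φ (a • x) = algebraMap ℤ_[p] S a * φ x from
          (map_smul φ' a x).trans (Algebra.smul_def _ _), map_mul, map_mul, hx,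
          iterateFrobenius_def, hcoeff]
    intro x
    obtain ⟨y, rfl⟩ := hφ x
    have := hlocus y
    rw [← Ideal.Quotient.eq_zero_iff_mem, map_sub, map_pow]
    rw [iterateFrobenius_def] at this
    rw [this, sub_self]
  have ht : 1 < p ^ t := Nat.one_lt_pow (Nat.totient_pos.mpr hmpos).ne' hp.out.one_lt
  -- For x in 𝔪, x(1 - x^(p^t - 1)) lies in `J` and its second factor is a unit.
  have hmJ : 𝔪 = J := by
    refine le_antisymm (fun x hx => ?_) hJm
    have h1 : IsUnit (1 - x ^ (p ^ t - 1)) :=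
      IsLocalRing.isUnit_one_sub_self_of_mem_nonunits _
        ((IsLocalRing.mem_maximalIdeal _).mp (𝔪.pow_mem_of_mem hx _ (by omega)))
    have h2 : x * (1 - x ^ (p ^ t - 1)) ∈ J := by
      have h3 := J.neg_mem (hfrob x)
      rwa [neg_sub, ← Nat.sub_add_cancel ht.le, pow_succ',
        show x - x * x ^ (p ^ t - 1) = x * (1 - x ^ (p ^ t - 1)) by ring] at h3
    exact (Ideal.mul_unit_mem_iff_mem J h1).mp h2
  have hprin : 𝔪.IsPrincipal := by
    rw [hmJ]
    rcases k with _ | k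
    · refine ⟨(p : S), ?_⟩
      rw [pow_zero, pow_one] at hzn
      simp only [J, hzn, sub_self]
      exact Submodule.span_insert_zero
    · refine ⟨z ^ m - 1, ?_⟩
      have hprim : IsPrimitiveRoot (z ^ m) (p ^ (k + 1)) := by
        refine IsPrimitiveRoot.pow (n := orderOf z) ?_ (IsPrimitiveRoot.orderOf z) ?_
        · rw [hz]
          exact orderOf_pos ζ
        · rw [hz, hn, mul_comm]
      have hroot := hprim.isRoot_cyclotomic (pow_pos hp.out.pos _)
      -- The cyclotomic polynomial of a power of p vanishes at z^m and equals p at 1, so z^m - 1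
      -- divides p.
      have hdvd := Polynomial.sub_dvd_eval_sub (z ^ m) 1 (Polynomial.cyclotomic (p ^ (k + 1)) S)
      rw [hroot.eq_zero, Polynomial.eval_one_cyclotomic_prime_pow, zero_sub, dvd_neg] at hdvd
      refine le_antisymm (Ideal.span_le.mpr ?_) (Ideal.span_mono (by simp))
      rintro x (rfl | rfl)
      · exact Ideal.mem_span_singleton_self _
      · exact Ideal.mem_span_singleton.mpr hdvd
  have hfield : ¬ IsField S := fun h =>
    hpS (by
      have := (IsLocalRing.isField_iff_maximalIdeal_eq.mp h)
      rwa [← Ideal.mem_bot, ← this])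
  refine ⟨hloc, ((IsDiscreteValuationRing.TFAE S hfield).out 0 4).mpr hprin, ?_⟩
  have hroots : ∀ x : IsLocalRing.ResidueField S, x ^ p ^ t - x = 0 := by
    intro x
    obtain ⟨y, rfl⟩ := IsLocalRing.residue_surjective x
    rw [← map_pow, ← map_sub, IsLocalRing.residue_eq_zero_iff]
    exact hJm (hfrob y)
  let f : Polynomial (IsLocalRing.ResidueField S) := Polynomial.X ^ p ^ t - Polynomial.X
  have hf : f ≠ 0 := FiniteField.X_pow_card_sub_X_ne_zero _ ht
  refine Set.finite_univ_iff.mp ((Polynomial.finite_setOfPred_isRoot hf).subset fun x _ => ?_)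
  simpa [f, Polynomial.IsRoot] using hroots x

/-! ### Primitive idempotents and the ring eℤ_p[Γ] -/

/-- By semisimplicity the ideal (a) is generated by an idempotent f with ef = f, and primitivity
leaves f = 0 or f = e. In the first case a = 0; in the second e is a multiple of a, so ab = 0 forces
b = eb = 0. -/
theorem IsPrimitiveIdempotent.noZeroDivisors_corner {S : Type*} [CommRing S] [IsSemisimpleRing S]
    {e : S} (he : IsPrimitiveIdempotent e) : NoZeroDivisors he.idem.Corner where
  eq_zero_or_eq_zero_of_mul_eq_zero := by
    intro a b hab
    have hea : e * a.1 = a.1 := ((Subsemigroup.mem_corner_iff he.idem).mp a.2).1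
    have heb : e * b.1 = b.1 := ((Subsemigroup.mem_corner_iff he.idem).mp b.2).1
    have hab' : a.1 * b.1 = 0 := congrArg Subtype.val hab
    obtain ⟨J, hJ⟩ := exists_isCompl (Ideal.span {a.1})
    have hinf : ∀ x ∈ Ideal.span {a.1}, x ∈ J → x = 0 := fun x hx hx' =>
      Submodule.disjoint_def.mp hJ.disjoint x hx hx'
    obtain ⟨f, hf, g, hg, hfg⟩ := Submodule.mem_sup.mp
      (hJ.sup_eq_top ▸ Submodule.mem_top : (1 : S) ∈ Ideal.span {a.1} ⊔ J)
    have hmulg : ∀ x ∈ Ideal.span {a.1}, x * g = 0 := fun x hx =>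
      hinf _ (Ideal.mul_mem_right _ _ hx) (Ideal.mul_mem_left _ _ hg)
    have hmulf : ∀ x ∈ Ideal.span {a.1}, x * f = x := fun x hx => by
      have h := hmulg x hx
      linear_combination x * hfg - h
    have hff : f * f = f := hmulf f hf
    obtain ⟨c, hc⟩ := Ideal.mem_span_singleton.mp hf
    have hef : e * f = f := by rw [hc, ← mul_assoc, hea]
    have hfe : f * (e - f) = 0 := by rw [mul_sub, mul_comm f e, hef, hff, sub_self]
    have hidem : IsIdempotentElem (e - f) := by
      have h := he.idem.eq
      change (e - f) * (e - f) = e - f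
      linear_combination h - 2 * hef + hff
    rcases he.indecomposable f (e - f) hff hidem hfe (by rw [mul_comm, hfe])
      (add_sub_cancel _ _) with h | h
    · left
      refine Subtype.ext ?_
      have := hmulf a.1 (Ideal.mem_span_singleton_self _)
      rw [h, mul_zero] at this
      exact this.symm
    · right
      refine Subtype.ext ?_
      rw [sub_eq_zero] at h
      change b.1 = 0
      calc b.1 = e * b.1 := heb.symm
        _ = a.1 * c * b.1 := by rw [← hc, ← h]
        _ = 0 := by rw [mul_right_comm, hab', zero_mul]

section

variable (p : ℕ) [Fact p.Prime] {Γ : Type u} [CommGroup Γ]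

/-- The surjection `ℤ_p[Γ] → e ℤ_p[Γ]`, `x ↦ e x`. -/
noncomputable def idempotentSubringProjection {e : MonoidAlgebra ℚ_[p] Γ}
    (he : IsIdempotentElem e) : MonoidAlgebra ℤ_[p] Γ →+* idempotentSubring p he where
  toFun x := ⟨⟨e * MonoidAlgebra.mapRingHom Γ (algebraMap ℤ_[p] ℚ_[p]) x,
    (Subsemigroup.mem_corner_iff he).mpr
      ⟨by rw [← mul_assoc, he.eq], by rw [mul_right_comm, he.eq]⟩⟩, x, rfl⟩
  map_one' := Subtype.ext (Subtype.ext
    ((congrArg (e * ·) (map_one _)).trans (mul_one e)))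
  map_mul' x y := Subtype.ext (Subtype.ext (by
    let f := MonoidAlgebra.mapRingHom Γ (algebraMap ℤ_[p] ℚ_[p])
    change e * f (x * y) = (e * f x) * (e * f y)
    rw [map_mul, mul_mul_mul_comm, he.eq]))
  map_zero' := Subtype.ext (Subtype.ext
    ((congrArg (e * ·) (map_zero _)).trans (mul_zero e)))
  map_add' x y := Subtype.ext (Subtype.ext
    ((congrArg (e * ·) (map_add _ x y)).trans (mul_add e _ _)))

theorem idempotentSubringProjection_surjective {e : MonoidAlgebra ℚ_[p] Γ}
    (he : IsIdempotentElem e) : Function.Surjective (idempotentSubringProjection p he) := by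
  rintro ⟨y, x, hx⟩
  exact ⟨x, Subtype.ext (Subtype.ext hx.symm)⟩

theorem IsPrimitiveIdempotent.isDomain_idempotentSubring [Finite Γ] {e : MonoidAlgebra ℚ_[p] Γ}
    (he : IsPrimitiveIdempotent e) : IsDomain (idempotentSubring p he.idem) := by
  have := he.noZeroDivisors_corner
  have : Nontrivial he.idem.Corner :=
    ⟨⟨1, 0, fun h => he.ne_zero (congrArg Subtype.val h)⟩⟩
  have : IsDomain he.idem.Corner := NoZeroDivisors.to_isDomain _
  infer_instance

theorem IsPrimitiveIdempotent.isDiscreteValuationRing_idempotentSubring [Finite Γ]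
    {e : MonoidAlgebra ℚ_[p] Γ} (he : IsPrimitiveIdempotent e) :
    ∃ (_ : IsDomain (idempotentSubring p he.idem)) (_ : IsLocalRing (idempotentSubring p he.idem)),
      IsDiscreteValuationRing (idempotentSubring p he.idem) ∧
      Finite (IsLocalRing.ResidueField (idempotentSubring p he.idem)) := by
  have hdom := he.isDomain_idempotentSubring p
  refine ⟨hdom, PadicInt.isDiscreteValuationRing_of_surjective (idempotentSubringProjection p he.idem)
    (idempotentSubringProjection_surjective p he.idem) fun h => he.ne_zero ?_⟩
  rw [← map_natCast (idempotentSubringProjection p he.idem)] at h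
  have h1 : e * MonoidAlgebra.mapRingHom Γ (algebraMap ℤ_[p] ℚ_[p]) (p : MonoidAlgebra ℤ_[p] Γ) = 0 :=
    congrArg (fun x => x.1.1) h
  rw [map_natCast, mul_comm, ← nsmul_eq_mul, ← Nat.cast_smul_eq_nsmul ℚ_[p]] at h1
  exact (smul_eq_zero.mp h1).resolve_left (Nat.cast_ne_zero.mpr (Fact.out : p.Prime).ne_zero)

end

/-! ### Counting submodules of finite index in free modules -/

section LatticeZeta

variable {R : Type u} [CommRing R]

theorem Submodule.card_quotient_prod {A B : Type*} [AddCommGroup A] [Module R A] [AddCommGroup B]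
    [Module R B] (L : Submodule R (A × B)) :
    Nat.card ((A × B) ⧸ L) = Nat.card (A ⧸ L.comap (LinearMap.inl R A B)) *
      Nat.card (B ⧸ L.map (LinearMap.snd R A B)) := by
  simp only [← Submodule.cardQuot_apply, Submodule.cardQuot]
  have h1 : (L.comap (LinearMap.inl R A B)).toAddSubgroup =
      L.toAddSubgroup.comap (AddMonoidHom.inl A B) := rfl
  have h2 : (L.map (LinearMap.snd R A B)).toAddSubgroup =
      L.toAddSubgroup.map (AddMonoidHom.snd A B) := rfl
  have h3 : (AddMonoidHom.inl A B).range = (AddMonoidHom.snd A B).ker := by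
    ext ⟨x, y⟩
    rw [AddMonoidHom.mem_ker, AddMonoidHom.mem_range]
    exact ⟨by rintro ⟨z, hz⟩; exact (congrArg Prod.snd hz).symm,
      fun hy => ⟨x, Prod.ext rfl hy.symm⟩⟩
  have h4 : (AddMonoidHom.snd A B).range = ⊤ :=
    AddMonoidHom.range_eq_top.mpr Prod.snd_surjective
  rw [h1, h2, AddSubgroup.index_comap, AddSubgroup.index_map, h3, h4, AddSubgroup.index_top,
    mul_one, ← AddSubgroup.relIndex_sup_left, AddSubgroup.relIndex_mul_index le_sup_left]

variable (R) in
/-- The zeta function counting the submodules of finite index of `F`, at a natural number. -/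
noncomputable def latticeZeta (F : Type*) [AddCommGroup F] [Module R F] (s : ℕ) : ℝ≥0∞ :=
  ∑' L : {L : Submodule R F // Finite (F ⧸ L)}, (Nat.card (F ⧸ L.1) : ℝ≥0∞)⁻¹ ^ s

/-- Submodules of finite index of isomorphic modules correspond to each other. -/
def LinearEquiv.finiteIndexSubmodules {F F' : Type*} [AddCommGroup F] [Module R F]
    [AddCommGroup F'] [Module R F'] (e : F ≃ₗ[R] F') :
    {L : Submodule R F // Finite (F ⧸ L)} ≃ {L : Submodule R F' // Finite (F' ⧸ L)} :=
  (Submodule.orderIsoMapComap e).toEquiv.subtypeEquiv fun L =>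
    (Submodule.Quotient.equiv L _ e rfl).toEquiv.finite_iff

theorem latticeZeta_congr {F F' : Type*} [AddCommGroup F] [Module R F]
    [AddCommGroup F'] [Module R F'] (e : F ≃ₗ[R] F') (s : ℕ) :
    latticeZeta R F s = latticeZeta R F' s := by
  refine (Equiv.tsum_eq e.finiteIndexSubmodules _).symm.trans ?_ |>.symm
  refine tsum_congr fun L => ?_
  rw [Nat.card_congr (Submodule.Quotient.equiv L.1 _ e rfl).toEquiv]
  rfl

/-- The submodule of `A × R` with intersection `L` with `A`, with projection to `R` generated by
`a`, and with the class `v` of the lifts of `a`. -/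
def Submodule.extendProd {A : Type*} [AddCommGroup A] [Module R A] (L : Submodule R A) (a : R)
    (v : A ⧸ L) : Submodule R (A × R) where
  carrier := {z | ∃ r, z.2 = r * a ∧ L.mkQ z.1 = r • v}
  add_mem' := by
    rintro z w ⟨r, hr, hr'⟩ ⟨s, hs, hs'⟩
    exact ⟨r + s, by rw [Prod.snd_add, hr, hs, add_mul],
      by rw [Prod.fst_add, map_add, hr', hs', add_smul]⟩
  zero_mem' := ⟨0, by simp, by simp⟩
  smul_mem' := by
    rintro c z ⟨r, hr, hr'⟩
    exact ⟨c * r, by rw [Prod.smul_snd, hr, smul_eq_mul, mul_assoc],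
      by rw [Prod.smul_fst, map_smul, hr', mul_smul]⟩

theorem Submodule.mem_extendProd {A : Type*} [AddCommGroup A] [Module R A] {L : Submodule R A}
    {a : R} {v : A ⧸ L} {z : A × R} :
    z ∈ L.extendProd a v ↔ ∃ r, z.2 = r * a ∧ L.mkQ z.1 = r • v := Iff.rfl

theorem Submodule.comap_inl_extendProd [IsDomain R] {A : Type*} [AddCommGroup A] [Module R A]
    (L : Submodule R A) {a : R} (ha : a ≠ 0) (v : A ⧸ L) :
    (L.extendProd a v).comap (LinearMap.inl R A R) = L := by
  ext x
  rw [Submodule.mem_comap, Submodule.mem_extendProd]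
  constructor
  · rintro ⟨r, hr, hr'⟩
    have hr0 : r = 0 := (mul_eq_zero.mp hr.symm).resolve_right ha
    rw [hr0, zero_smul] at hr'
    exact (Submodule.Quotient.mk_eq_zero L).mp hr'
  · intro hx
    exact ⟨0, by simp, by simpa using hx⟩

theorem Submodule.map_snd_extendProd {A : Type*} [AddCommGroup A] [Module R A]
    (L : Submodule R A) (a : R) (v : A ⧸ L) :
    (L.extendProd a v).map (LinearMap.snd R A R) = Ideal.span {a} := by
  ext y
  rw [Submodule.mem_map, Ideal.mem_span_singleton']
  constructor
  · rintro ⟨z, ⟨r, hr, -⟩, rfl⟩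
    exact ⟨r, hr.symm⟩
  · rintro ⟨r, rfl⟩
    obtain ⟨x, hx⟩ := L.mkQ_surjective (r • v)
    exact ⟨(x, r * a), ⟨r, rfl, hx⟩, rfl⟩

theorem Submodule.mem_extendProd_self [IsDomain R] {A : Type*} [AddCommGroup A] [Module R A]
    (L : Submodule R A) {a : R} (ha : a ≠ 0) (v : A ⧸ L) (x : A) :
    (x, a) ∈ L.extendProd a v ↔ L.mkQ x = v := by
  rw [Submodule.mem_extendProd]
  constructor
  · rintro ⟨r, hr, hr'⟩
    have : r = 1 := by
      refine mul_right_cancel₀ ha ?_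
      rw [one_mul]
      exact hr.symm
    rwa [this, one_smul] at hr'
  · intro hx
    exact ⟨1, (one_mul a).symm, by rwa [one_smul]⟩

/-- Subtracting r(x, a) from an element (y, ra) leaves an element of `A`, so `L` is recovered from
its intersection with `A`, the generator `a` and one lift of it. -/
theorem Submodule.eq_extendProd [IsDomain R] {A : Type*} [AddCommGroup A] [Module R A]
    (L : Submodule R (A × R)) {a : R} (hL : L.map (LinearMap.snd R A R) = Ideal.span {a}) {x : A}
    (hx : (x, a) ∈ L) :
    (L.comap (LinearMap.inl R A R)).extendProd a (Submodule.mkQ _ x) = L := by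
  have key : ∀ (y : A) (r : R), (y, r * a) ∈ L ↔ y - r • x ∈ L.comap (LinearMap.inl R A R) := by
    intro y r
    have : (y, r * a) = LinearMap.inl R A R (y - r • x) + r • (x, a) := by simp
    rw [this, Submodule.add_mem_iff_left _ (L.smul_mem r hx)]
    rfl
  ext ⟨y, b⟩
  rw [Submodule.mem_extendProd]
  constructor
  · rintro ⟨r, hr, hr'⟩
    obtain rfl : b = r * a := hr
    rw [key, ← Submodule.Quotient.mk_eq_zero, Submodule.Quotient.mk_sub, sub_eq_zero]
    exact hr'
  · intro hb
    have : b ∈ Ideal.span {a} := hL ▸ Submodule.mem_map_of_mem (f := LinearMap.snd R A R) hb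
    obtain ⟨r, rfl⟩ := Ideal.mem_span_singleton'.mp this
    refine ⟨r, rfl, ?_⟩
    rw [key, ← Submodule.Quotient.mk_eq_zero, Submodule.Quotient.mk_sub, sub_eq_zero] at hb
    exact hb

theorem Irreducible.span_pow_injective [IsDomain R] {π : R} (hπ : Irreducible π) {j k : ℕ}
    (h : Ideal.span {π ^ j} = Ideal.span {π ^ k}) : j = k :=
  (pow_dvd_pow_iff hπ.ne_zero hπ.not_isUnit).mp (Ideal.mem_span_singleton.mp
      (h ▸ Ideal.mem_span_singleton_self _)) |>.antisymm
    ((pow_dvd_pow_iff hπ.ne_zero hπ.not_isUnit).mp (Ideal.mem_span_singleton.mp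
      (h.symm ▸ Ideal.mem_span_singleton_self _)))

variable [IsDomain R] [IsDiscreteValuationRing R]

theorem IsDiscreteValuationRing.infinite : Infinite R := by
  by_contra h
  have : Finite R := not_infinite_iff_finite.mp h
  exact IsDiscreteValuationRing.not_isField R (Finite.isField_of_domain R)

theorem IsDiscreteValuationRing.card_quotient_span_pow {π : R} (hπ : Irreducible π) (k : ℕ) :
    Nat.card (R ⧸ Ideal.span {π ^ k}) = Nat.card (IsLocalRing.ResidueField R) ^ k := by
  rw [← Ideal.span_singleton_pow, ← hπ.maximalIdeal_eq, ← Submodule.cardQuot_apply,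
    cardQuot_pow_of_prime (IsDiscreteValuationRing.not_a_field R), Submodule.cardQuot_apply]
  rfl

theorem Submodule.card_quotient_extendProd {A : Type*} [AddCommGroup A] [Module R A]
    (L : Submodule R A) {π : R} (hπ : Irreducible π) (k : ℕ) (v : A ⧸ L) :
    Nat.card ((A × R) ⧸ L.extendProd (π ^ k) v) =
      Nat.card (A ⧸ L) * Nat.card (IsLocalRing.ResidueField R) ^ k := by
  rw [Submodule.card_quotient_prod, Submodule.map_snd_extendProd,
    Submodule.comap_inl_extendProd _ (pow_ne_zero k hπ.ne_zero),
    IsDiscreteValuationRing.card_quotient_span_pow hπ]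

variable [Finite (IsLocalRing.ResidueField R)]

/-- The submodules of finite index of `A × R` over a discrete valuation ring `R`. -/
noncomputable def finiteIndexSubmodulesProdEquiv (A : Type*) [AddCommGroup A] [Module R A] {π : R}
    (hπ : Irreducible π) :
    (Σ L : {L : Submodule R A // Finite (A ⧸ L)}, ℕ × (A ⧸ L.1)) ≃
      {L : Submodule R (A × R) // Finite ((A × R) ⧸ L)} :=
  Equiv.ofBijective
    (fun x => ⟨x.1.1.extendProd (π ^ x.2.1) x.2.2, by
      have := x.1.2
      refine Nat.finite_of_card_ne_zero ?_
      rw [Submodule.card_quotient_extendProd _ hπ]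
      exact mul_ne_zero Nat.card_pos.ne' (pow_ne_zero _ Nat.card_pos.ne')⟩)
    (by
      constructor
      · rintro ⟨⟨L, hL⟩, j, v⟩ ⟨⟨L', hL'⟩, k, w⟩ h
        replace h : L.extendProd (π ^ j) v = L'.extendProd (π ^ k) w := congrArg Subtype.val h
        obtain rfl : L = L' := by
          rw [← L.comap_inl_extendProd (pow_ne_zero j hπ.ne_zero) v, h,
            L'.comap_inl_extendProd (pow_ne_zero k hπ.ne_zero) w]
        obtain rfl : j = k := by
          refine hπ.span_pow_injective ?_
          rw [← L.map_snd_extendProd _ v, h, L.map_snd_extendProd]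
        obtain ⟨x, rfl⟩ := L.mkQ_surjective v
        have := (L.mem_extendProd_self (pow_ne_zero j hπ.ne_zero) (L.mkQ x) x).mpr rfl
        rw [h, L.mem_extendProd_self (pow_ne_zero j hπ.ne_zero)] at this
        rw [this]
      · rintro ⟨L, hL⟩
        have hcard := L.card_quotient_prod
        have hne : Nat.card ((A × R) ⧸ L) ≠ 0 := Nat.card_pos.ne'
        rw [hcard] at hne
        have hfin : Finite (R ⧸ L.map (LinearMap.snd R A R)) :=
          Nat.finite_of_card_ne_zero (right_ne_zero_of_mul hne)
        -- `R` is infinite, so an ideal of finite index is nonzero and hence generated by a power of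
        -- `π`.
        have hbot : L.map (LinearMap.snd R A R) ≠ ⊥ := by
          intro h
          rw [h] at hfin
          have := IsDiscreteValuationRing.infinite (R := R)
          exact not_finite_iff_infinite.mpr this
            ((Submodule.quotEquivOfEqBot (⊥ : Submodule R R) rfl).toEquiv.finite_iff.mp hfin)
        obtain ⟨k, hk⟩ := IsDiscreteValuationRing.ideal_eq_span_pow_irreducible hbot hπ
        obtain ⟨⟨x, y⟩, hx, hy⟩ : π ^ k ∈ L.map (LinearMap.snd R A R) :=
          hk ▸ Ideal.mem_span_singleton_self _
        obtain rfl : y = π ^ k := hy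
        exact ⟨⟨⟨_, Nat.finite_of_card_ne_zero (left_ne_zero_of_mul hne)⟩, k, Submodule.mkQ _ x⟩,
          Subtype.ext (L.eq_extendProd hk hx)⟩)

/-- A submodule L of index N in `A` extends, for each k, in N ways to index N q^k. These N choices
cancel one factor 1/N, which lowers the exponent from s + 1 to s; the sum over k is a geometric
series. -/
theorem latticeZeta_prod (A : Type*) [AddCommGroup A] [Module R A] (s : ℕ) :
    latticeZeta R (A × R) (s + 1) = latticeZeta R A s *
      (1 - (Nat.card (IsLocalRing.ResidueField R) : ℝ≥0∞)⁻¹ ^ (s + 1))⁻¹ := by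
  obtain ⟨π, hπ⟩ := IsDiscreteValuationRing.exists_irreducible R
  set q : ℝ≥0∞ := (Nat.card (IsLocalRing.ResidueField R) : ℝ≥0∞)
  rw [latticeZeta, ← Equiv.tsum_eq (finiteIndexSubmodulesProdEquiv A hπ), ENNReal.tsum_sigma',
    latticeZeta, ← ENNReal.tsum_mul_right]
  refine tsum_congr fun L => ?_
  have := L.2
  have hpos : Nat.card (A ⧸ L.1) ≠ 0 := Nat.card_pos.ne'
  set N : ℝ≥0∞ := (Nat.card (A ⧸ L.1) : ℝ≥0∞) with hN
  have hN0 : N ≠ 0 := by rw [hN]; exact_mod_cast hpos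
  have hNt : N ≠ ⊤ := ENNReal.natCast_ne_top _
  rw [ENNReal.tsum_prod', ← ENNReal.tsum_geometric, ← ENNReal.tsum_mul_left]
  refine tsum_congr fun k => ?_
  have hterm : ∀ v : A ⧸ L.1,
      (Nat.card ((A × R) ⧸ ((finiteIndexSubmodulesProdEquiv A hπ) ⟨L, k, v⟩).1) : ℝ≥0∞)⁻¹ ^ (s + 1)
        = N⁻¹ ^ (s + 1) * (q⁻¹ ^ (s + 1)) ^ k := by
    intro v
    have : Nat.card ((A × R) ⧸ ((finiteIndexSubmodulesProdEquiv A hπ) ⟨L, k, v⟩).1) = _ :=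
      Submodule.card_quotient_extendProd L.1 hπ k v
    rw [this, Nat.cast_mul, Nat.cast_pow, ENNReal.mul_inv (Or.inl hN0) (Or.inl hNt), mul_pow,
      ENNReal.inv_pow, ← pow_mul, ← pow_mul, mul_comm k]
  have : Fintype (A ⧸ L.1) := Fintype.ofFinite _
  rw [tsum_congr hterm, tsum_fintype, Finset.sum_const, Finset.card_univ, nsmul_eq_mul,
    ← Nat.card_eq_fintype_card, ← mul_assoc, pow_succ', ← mul_assoc,
    ENNReal.mul_inv_cancel hN0 hNt, one_mul]

/-- Removing a coordinate lowers the exponent by one, down to exponent 1 on the zero module, so the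
factors have exponents 2, ..., n + 1. -/
theorem latticeZeta_pi (n : ℕ) :
    latticeZeta R (Fin n → R) (n + 1) = ∏ i ∈ Finset.range n,
      (1 - (Nat.card (IsLocalRing.ResidueField R) : ℝ≥0∞)⁻¹ ^ (i + 2))⁻¹ := by
  induction n with
  | zero =>
    have h1 : ∀ L : {L : Submodule R (Fin 0 → R) // Finite ((Fin 0 → R) ⧸ L)},
        (Nat.card ((Fin 0 → R) ⧸ L.1) : ℝ≥0∞)⁻¹ ^ 1 = 1 := by
      intro L
      have : Subsingleton ((Fin 0 → R) ⧸ L.1) := (Submodule.Quotient.mk_surjective _).subsingleton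
      rw [Nat.card_unique]
      simp
    have : Subsingleton {L : Submodule R (Fin 0 → R) // Finite ((Fin 0 → R) ⧸ L)} := inferInstance
    rw [latticeZeta, tsum_eq_single ⟨⊤, inferInstance⟩ fun L hL => absurd (Subsingleton.elim _ _) hL,
      h1, Finset.prod_range_zero]
  | succ n ih =>
    rw [Finset.prod_range_succ, ← ih, ← latticeZeta_prod]
    exact latticeZeta_congr ((Fin.consLinearEquiv R fun _ : Fin (n + 1) => R).symm.trans
      (LinearEquiv.prodComm R _ _)) _

theorem countable_finiteIndexSubmodules_pi (n : ℕ) :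
    Countable {L : Submodule R (Fin n → R) // Finite ((Fin n → R) ⧸ L)} := by
  obtain ⟨π, hπ⟩ := IsDiscreteValuationRing.exists_irreducible R
  induction n with
  | zero => infer_instance
  | succ n ih =>
    have : ∀ L : {L : Submodule R (Fin n → R) // Finite ((Fin n → R) ⧸ L)},
      Finite ((Fin n → R) ⧸ L.1) := fun L => L.2
    exact (((Fin.consLinearEquiv R fun _ : Fin (n + 1) => R).symm.trans
      (LinearEquiv.prodComm R _ _)).finiteIndexSubmodules.trans
        (finiteIndexSubmodulesProdEquiv (Fin n → R) hπ).symm).countable_iff.mpr inferInstance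

end LatticeZeta

/-! ### Surjections and generating families -/

/-- The surjective `R`-linear maps from `N` to `M`. -/
abbrev SurjectiveLinearMap (R : Type*) [CommRing R] (N M : Type*) [AddCommGroup N] [Module R N]
    [AddCommGroup M] [Module R M] : Type _ :=
  {f : N →ₗ[R] M // Function.Surjective f}

namespace SurjectiveLinearMap

variable {R : Type u} [CommRing R]

/-- Isomorphic modules have the same surjections to a module. -/
def congrLeft {N N' : Type*} (M : Type*) [AddCommGroup N] [Module R N] [AddCommGroup N']
    [Module R N'] [AddCommGroup M] [Module R M] (e : N ≃ₗ[R] N') :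
    SurjectiveLinearMap R N M ≃ SurjectiveLinearMap R N' M where
  toFun f := ⟨f.1 ∘ₗ e.symm.toLinearMap, f.2.comp e.symm.surjective⟩
  invFun f := ⟨f.1 ∘ₗ e.toLinearMap, f.2.comp e.surjective⟩
  left_inv f := by ext x; simp
  right_inv f := by ext x; simp

/-- A surjection is determined by its kernel and the isomorphism which it induces. -/
noncomputable def sigmaQuotientEquiv (F N : Type*) [AddCommGroup F] [Module R F] [AddCommGroup N]
    [Module R N] :
    (Σ L : {L : Submodule R F // Nonempty ((F ⧸ L) ≃ₗ[R] N)}, (F ⧸ L.1) ≃ₗ[R] N) ≃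
      SurjectiveLinearMap R F N :=
  Equiv.ofBijective
    (fun x => ⟨x.2.toLinearMap ∘ₗ x.1.1.mkQ, x.2.surjective.comp x.1.1.mkQ_surjective⟩)
    (by
      constructor
      · rintro ⟨⟨L, hL⟩, g⟩ ⟨⟨L', hL'⟩, g'⟩ h
        replace h : g.toLinearMap ∘ₗ L.mkQ = g'.toLinearMap ∘ₗ L'.mkQ := congrArg Subtype.val h
        obtain rfl : L = L' := by
          have := congrArg LinearMap.ker h
          simpa only [LinearEquiv.ker_comp, Submodule.ker_mkQ] using this
        obtain rfl : g = g' := LinearEquiv.toLinearMap_injective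
          (LinearMap.cancel_right L.mkQ_surjective |>.mp h)
        rfl
      · rintro ⟨f, hf⟩
        exact ⟨⟨⟨_, ⟨f.quotKerEquivOfSurjective hf⟩⟩, f.quotKerEquivOfSurjective hf⟩,
          Subtype.ext (LinearMap.ext fun x => rfl)⟩)

/-- The surjections with a given kernel form a torsor under Aut(N). -/
theorem card_eq_mul_card_linearEquiv (F N : Type*) [AddCommGroup F] [Module R F] [AddCommGroup N]
    [Module R N] :
    Nat.card (SurjectiveLinearMap R F N) =
      Nat.card {L : Submodule R F // Nonempty ((F ⧸ L) ≃ₗ[R] N)} * Nat.card (N ≃ₗ[R] N) := by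
  have e : (Σ L : {L : Submodule R F // Nonempty ((F ⧸ L) ≃ₗ[R] N)}, (F ⧸ L.1) ≃ₗ[R] N) ≃
      {L : Submodule R F // Nonempty ((F ⧸ L) ≃ₗ[R] N)} × (N ≃ₗ[R] N) :=
    (Equiv.sigmaCongrRight fun L : {L : Submodule R F // Nonempty ((F ⧸ L) ≃ₗ[R] N)} => (⟨fun g => L.2.some.symm.trans g, fun g => L.2.some.trans g,
      fun g => by ext; simp, fun g => by ext; simp⟩ : ((F ⧸ L.1) ≃ₗ[R] N) ≃ (N ≃ₗ[R] N))).trans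
      (Equiv.sigmaEquivProd _ _)
  rw [← Nat.card_prod, ← Nat.card_congr e, Nat.card_congr (sigmaQuotientEquiv F N)]

/-- Surjections from a quotient are the surjections whose kernel contains the submodule. -/
def quotientEquiv {F : Type*} [AddCommGroup F] [Module R F] (M : Type*) [AddCommGroup M]
    [Module R M] (L : Submodule R F) :
    SurjectiveLinearMap R (F ⧸ L) M ≃ {f : SurjectiveLinearMap R F M // L ≤ LinearMap.ker f.1} where
  toFun f := ⟨⟨f.1 ∘ₗ L.mkQ, f.2.comp L.mkQ_surjective⟩, fun x hx => by
    simp [(Submodule.Quotient.mk_eq_zero L).mpr hx]⟩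
  invFun f := ⟨L.liftQ f.1.1 f.2, fun y => by
    obtain ⟨x, hx⟩ := f.1.2 y
    exact ⟨L.mkQ x, by simpa using hx⟩⟩
  left_inv f := Subtype.ext (Submodule.linearMap_qext _ (LinearMap.ext fun x => by simp))
  right_inv f := Subtype.ext (Subtype.ext (LinearMap.ext fun x => by simp))

/-- Surjections from `R ^ n` are generating families. -/
noncomputable def piEquiv (n : ℕ) (N : Type*) [AddCommGroup N] [Module R N] :
    SurjectiveLinearMap R (Fin n → R) N ≃
      {f : Fin n → N // Submodule.span R (Set.range f) = ⊤} :=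
  (((Pi.basisFun R (Fin n)).constr ℕ).toEquiv.subtypeEquiv fun f => by
    rw [← (Pi.basisFun R (Fin n)).constr_range ℕ, LinearMap.range_eq_top]
    rfl).symm

instance (n : ℕ) (N : Type*) [AddCommGroup N] [Module R N] [Finite N] :
    Finite (SurjectiveLinearMap R (Fin n → R) N) :=
  (piEquiv n N).finite_iff.mpr inferInstance

theorem card_pi_le (n : ℕ) (N : Type*) [AddCommGroup N] [Module R N] [Finite N] :
    Nat.card (SurjectiveLinearMap R (Fin n → R) N) ≤ Nat.card N ^ n := by
  rw [Nat.card_congr (piEquiv n N)]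
  refine (Nat.card_le_card_of_injective _ Subtype.val_injective).trans ?_
  rw [Nat.card_fun, Nat.card_fin]

/-- A generating family still generates after any element is prepended. -/
theorem card_pi_mul_le (n : ℕ) (N : Type*) [AddCommGroup N] [Module R N] [Finite N] :
    Nat.card (SurjectiveLinearMap R (Fin n → R) N) * Nat.card N ≤
      Nat.card (SurjectiveLinearMap R (Fin (n + 1) → R) N) := by
  rw [Nat.card_congr (piEquiv n N), Nat.card_congr (piEquiv (n + 1) N), ← Nat.card_prod]
  refine Nat.card_le_card_of_injective
    (fun x => ⟨Fin.cons x.2 x.1.1, top_le_iff.mp (x.1.2.ge.trans (Submodule.span_mono ?_))⟩) ?_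
  · rintro _ ⟨i, rfl⟩
    exact ⟨i.succ, Fin.cons_succ _ _ _⟩
  · rintro ⟨⟨f, hf⟩, x⟩ ⟨⟨g, hg⟩, y⟩ h
    obtain ⟨rfl, rfl⟩ := Fin.cons_injective2 (α := fun _ => N) (congrArg Subtype.val h)
    rfl

/-- Union bound: a family that does not generate lies in a proper submodule, namely its span. -/
theorem card_pow_le_card_pi_add (n : ℕ) (N : Type*) [AddCommGroup N] [Module R N] [Finite N] :
    Nat.card N ^ n ≤ Nat.card (SurjectiveLinearMap R (Fin n → R) N) +
      ∑ᶠ L : {L : Submodule R N // L ≠ ⊤}, Nat.card L.1 ^ n := by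
  classical
  have : Fintype {L : Submodule R N // L ≠ ⊤} := Fintype.ofFinite _
  rw [Nat.card_congr (piEquiv n N), finsum_eq_sum_of_fintype]
  have hsurj : Function.Surjective (Sum.elim
      (fun f : {f : Fin n → N // Submodule.span R (Set.range f) = ⊤} => f.1)
      (fun x : Σ L : {L : Submodule R N // L ≠ ⊤}, Fin n → L.1 => fun i => (x.2 i : N))) := by
    intro f
    by_cases hf : Submodule.span R (Set.range f) = ⊤
    · exact ⟨Sum.inl ⟨f, hf⟩, rfl⟩
    · exact ⟨Sum.inr ⟨⟨_, hf⟩, fun i => ⟨f i, Submodule.subset_span ⟨i, rfl⟩⟩⟩, rfl⟩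
  have h := Nat.card_le_card_of_surjective _ hsurj
  rw [Nat.card_sum, Nat.card_sigma] at h
  simpa [Nat.card_fun] using h

/-- The probability that `n` random elements of a finite module generate it. -/
noncomputable def generatingProbability (R : Type*) [CommRing R] (N : Type*) [AddCommGroup N]
    [Module R N] (n : ℕ) : ℝ≥0∞ :=
  Nat.card (SurjectiveLinearMap R (Fin n → R) N) * (Nat.card N : ℝ≥0∞)⁻¹ ^ n

section Finite

variable (N : Type*) [AddCommGroup N] [Module R N] [Finite N]

theorem natCard_ne_zero : (Nat.card N : ℝ≥0∞) ≠ 0 :=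
  Nat.cast_ne_zero.mpr Nat.card_pos.ne'

theorem generatingProbability_le_one (n : ℕ) : generatingProbability R N n ≤ 1 := by
  rw [generatingProbability, ← ENNReal.inv_pow, ← div_eq_mul_inv]
  refine ENNReal.div_le_of_le_mul ?_
  rw [one_mul]
  exact_mod_cast card_pi_le n N

theorem generatingProbability_mono : Monotone (generatingProbability R N) := by
  refine monotone_nat_of_le_succ fun n => ?_
  have h : (Nat.card (SurjectiveLinearMap R (Fin n → R) N) : ℝ≥0∞) * Nat.card N ≤
      Nat.card (SurjectiveLinearMap R (Fin (n + 1) → R) N) := by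
    exact_mod_cast card_pi_mul_le n N
  calc generatingProbability R N n
      = (Nat.card (SurjectiveLinearMap R (Fin n → R) N) : ℝ≥0∞) * Nat.card N *
          (Nat.card N : ℝ≥0∞)⁻¹ ^ (n + 1) := by
        rw [generatingProbability, pow_succ', mul_assoc, ← mul_assoc (Nat.card N : ℝ≥0∞),
          ENNReal.mul_inv_cancel (natCard_ne_zero N) (ENNReal.natCast_ne_top _), one_mul]
    _ ≤ _ := mul_le_mul_left h _

/-- The failure probability is at most the finite sum of (|L|/|N|)^n over proper submodules L, where
each ratio is less than 1. -/
theorem tendsto_generatingProbability :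
    Filter.Tendsto (generatingProbability R N) Filter.atTop (nhds 1) := by
  have : Fintype {L : Submodule R N // L ≠ ⊤} := Fintype.ofFinite _
  have hN0 := natCard_ne_zero N
  have hNt : (Nat.card N : ℝ≥0∞) ≠ ⊤ := ENNReal.natCast_ne_top _
  have hlt : ∀ L : {L : Submodule R N // L ≠ ⊤}, (Nat.card L.1 : ℝ≥0∞) / Nat.card N < 1 := by
    intro L
    rw [ENNReal.div_lt_iff (Or.inl hN0) (Or.inl hNt), one_mul, Nat.cast_lt]
    have : (L.1 : Set N) ≠ Set.univ := fun h => L.2 (SetLike.coe_injective h)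
    have h := Set.ncard_lt_ncard (Set.ssubset_univ_iff.mpr this) (Set.toFinite _)
    rwa [Set.ncard_univ, ← Nat.card_coe_set_eq] at h
  have herr : Filter.Tendsto (fun n : ℕ => ∑ L : {L : Submodule R N // L ≠ ⊤},
      ((Nat.card L.1 : ℝ≥0∞) / Nat.card N) ^ n) Filter.atTop (nhds 0) := by
    rw [← Finset.sum_const_zero (s := (Finset.univ : Finset {L : Submodule R N // L ≠ ⊤}))]
    exact tendsto_finsetSum _ fun L _ => ENNReal.tendsto_pow_atTop_nhds_zero_of_lt_one (hlt L)
  have hle : ∀ n, 1 ≤ generatingProbability R N n + ∑ L : {L : Submodule R N // L ≠ ⊤},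
      ((Nat.card L.1 : ℝ≥0∞) / Nat.card N) ^ n := by
    intro n
    have h : (Nat.card N : ℝ≥0∞) ^ n ≤ Nat.card (SurjectiveLinearMap R (Fin n → R) N) +
        ∑ L : {L : Submodule R N // L ≠ ⊤}, (Nat.card L.1 : ℝ≥0∞) ^ n := by
      have := card_pow_le_card_pi_add (R := R) n N
      rw [finsum_eq_sum_of_fintype] at this
      exact_mod_cast this
    have h2 := mul_le_mul_left h ((Nat.card N : ℝ≥0∞)⁻¹ ^ n)
    rw [← mul_pow, ENNReal.mul_inv_cancel hN0 hNt, one_pow, add_mul, Finset.sum_mul] at h2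
    simpa only [generatingProbability, div_eq_mul_inv, mul_pow] using h2
  have hsup := tendsto_atTop_iSup (generatingProbability_mono (R := R) N)
  have hone : ⨆ n, generatingProbability R N n = 1 := by
    refine le_antisymm (iSup_le (generatingProbability_le_one N)) ?_
    have := hsup.add herr
    rw [add_zero] at this
    exact ge_of_tendsto' this hle
  rwa [hone] at hsup

end Finite

end SurjectiveLinearMap

/-! ### Isomorphism classes and their representatives -/

namespace FiniteModuleClass

section Basic

variable {R : Type u} [CommRing R]

/-- A representative of an isomorphism class of finite modules. -/
noncomputable def rep (c : FiniteModuleClass.{u, v} R) : Type v :=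
  (Quotient.out c).1

noncomputable instance (c : FiniteModuleClass.{u, v} R) : AddCommGroup c.rep :=
  inferInstanceAs (AddCommGroup (Quotient.out c).1)

noncomputable instance (c : FiniteModuleClass.{u, v} R) : Module R c.rep :=
  inferInstanceAs (Module R (Quotient.out c).1)

instance (c : FiniteModuleClass.{u, v} R) : Finite c.rep :=
  (Quotient.out c).2

theorem mk_rep (c : FiniteModuleClass.{u, v} R) : mk R c.rep = c :=
  Quotient.out_eq c

theorem mk_eq_mk_iff {M N : Type v} [AddCommGroup M] [Module R M] [Finite M] [AddCommGroup N]
    [Module R N] [Finite N] : mk R M = mk R N ↔ Nonempty (M ≃ₗ[R] N) :=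
  Quotient.eq

theorem numSur_mk (N M : Type v) [AddCommGroup N] [Module R N] [Finite N] [AddCommGroup M]
    [Module R M] : (mk R N).numSur M = Nat.card (SurjectiveLinearMap R N M) :=
  rfl

variable (R) in
/-- The isomorphism class of a finite module in an arbitrary universe. -/
noncomputable def ofFinite (Q : Type*) [AddCommGroup Q] [Module R Q] [Finite Q] :
    FiniteModuleClass.{u, v} R :=
  mk R (Shrink.{v} Q)

theorem ofFinite_eq_iff {Q : Type*} [AddCommGroup Q] [Module R Q] [Finite Q]
    {c : FiniteModuleClass.{u, v} R} : ofFinite R Q = c ↔ Nonempty (Q ≃ₗ[R] c.rep) := by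
  rw [← mk_rep c, ofFinite, mk_eq_mk_iff, mk_rep]
  exact ⟨fun ⟨e⟩ => ⟨(Shrink.linearEquiv.{v} R Q).symm.trans e⟩,
    fun ⟨e⟩ => ⟨(Shrink.linearEquiv.{v} R Q).trans e⟩⟩

theorem numSur_eq_of_linearEquiv {Q : Type*} [AddCommGroup Q] [Module R Q]
    {c : FiniteModuleClass.{u, v} R} (e : Q ≃ₗ[R] c.rep) (M : Type v) [AddCommGroup M]
    [Module R M] : c.numSur M = Nat.card (SurjectiveLinearMap R Q M) := by
  rw [Nat.card_congr (SurjectiveLinearMap.congrLeft M e), ← numSur_mk, mk_rep]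

/-- The number of automorphisms times the number of elements of a finite module. -/
noncomputable def autMulCard (c : FiniteModuleClass.{u, v} R) : ℝ≥0∞ :=
  (Nat.card (c.rep ≃ₗ[R] c.rep) : ℝ≥0∞) * (Nat.card c.rep : ℝ≥0∞)

theorem autMulCard_mk (M : Type v) [AddCommGroup M] [Module R M] [Finite M] :
    (mk R M).autMulCard = (Nat.card (M ≃ₗ[R] M) : ℝ≥0∞) * (Nat.card M : ℝ≥0∞) := by
  obtain ⟨e⟩ := mk_eq_mk_iff.mp (mk_rep (mk R M))
  rw [autMulCard, Nat.card_congr e.toEquiv, Nat.card_congr (⟨fun g => (e.symm.trans g).trans e,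
    fun g => (e.trans g).trans e.symm, fun g => by ext; simp, fun g => by ext; simp⟩ :
    ((mk R M).rep ≃ₗ[R] (mk R M).rep) ≃ (M ≃ₗ[R] M))]

instance {M N : Type*} [AddCommGroup M] [Module R M] [Finite M] [AddCommGroup N] [Module R N]
    [Finite N] : Finite (M ≃ₗ[R] N) :=
  Finite.of_injective (fun f => (f : M → N)) DFunLike.coe_injective

theorem natCard_linearEquiv_ne_zero (M : Type*) [AddCommGroup M] [Module R M] [Finite M] :
    (Nat.card (M ≃ₗ[R] M) : ℝ≥0∞) ≠ 0 :=
  have : Nonempty (M ≃ₗ[R] M) := ⟨LinearEquiv.refl R M⟩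
  Nat.cast_ne_zero.mpr Nat.card_pos.ne'

theorem autMulCard_ne_zero (c : FiniteModuleClass.{u, v} R) : c.autMulCard ≠ 0 :=
  mul_ne_zero (natCard_linearEquiv_ne_zero _) (SurjectiveLinearMap.natCard_ne_zero _)

/-- A surjective endomorphism of a finite module is bijective. This is the diagonal coefficient of
the moment system. -/
theorem numSur_self (c : FiniteModuleClass.{u, v} R) :
    c.numSur c.rep = Nat.card (c.rep ≃ₗ[R] c.rep) := by
  rw [numSur_eq_of_linearEquiv (LinearEquiv.refl R _)]
  refine Nat.card_congr ⟨fun f => LinearEquiv.ofBijective f.1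
    (Finite.surjective_iff_bijective.mp f.2), fun g => ⟨g.toLinearMap, g.surjective⟩,
    fun f => Subtype.ext (LinearMap.ext fun x => rfl), fun g => LinearEquiv.ext fun x => rfl⟩

theorem card_fiber_ofFinite {F : Type*} [AddCommGroup F] [Module R F]
    (c : FiniteModuleClass.{u, v} R) :
    Nat.card (SurjectiveLinearMap R F c.rep) =
      Nat.card {L : {L : Submodule R F // Finite (F ⧸ L)} //
        haveI := L.2; ofFinite R (F ⧸ L.1) = c} * Nat.card (c.rep ≃ₗ[R] c.rep) := by
  rw [SurjectiveLinearMap.card_eq_mul_card_linearEquiv]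
  congr 1
  have hfin : ∀ L : {L : Submodule R F // Nonempty ((F ⧸ L) ≃ₗ[R] c.rep)}, Finite (F ⧸ L.1) :=
    fun L => L.2.some.toEquiv.finite_iff.mpr inferInstance
  refine Nat.card_congr ⟨fun L => ⟨⟨L.1, hfin L⟩, ?_⟩, fun L => ⟨L.1.1, ?_⟩,
    fun _ => rfl, fun _ => rfl⟩
  · have := hfin L
    exact ofFinite_eq_iff.mpr L.2
  · have := L.1.2
    exact ofFinite_eq_iff.mp L.2

end Basic

section DVR

variable {R : Type u} [CommRing R]

/-- The submodules are grouped by the class c of their quotient; #Sur(R^n, c)/|Aut c| of them have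
class c. -/
theorem tsum_finiteIndexSubmodules_comp_ofFinite (n : ℕ) (h : FiniteModuleClass.{u, v} R → ℝ≥0∞) :
    ∑' L : {L : Submodule R (Fin n → R) // Finite ((Fin n → R) ⧸ L)},
      (haveI := L.2; h (ofFinite R ((Fin n → R) ⧸ L.1))) =
    ∑' c : FiniteModuleClass.{u, v} R, h c *
      (Nat.card (SurjectiveLinearMap R (Fin n → R) c.rep) *
        (Nat.card (c.rep ≃ₗ[R] c.rep) : ℝ≥0∞)⁻¹) := by
  let cls : {L : Submodule R (Fin n → R) // Finite ((Fin n → R) ⧸ L)} →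
      FiniteModuleClass.{u, v} R := fun L => haveI := L.2; ofFinite R ((Fin n → R) ⧸ L.1)
  change ∑' L, h (cls L) = _
  rw [← (Equiv.sigmaFiberEquiv cls).tsum_eq, ENNReal.tsum_sigma']
  refine tsum_congr fun c => ?_
  have hcard := card_fiber_ofFinite (F := Fin n → R) c
  change _ = Nat.card {L // cls L = c} * _ at hcard
  have hpos := natCard_linearEquiv_ne_zero (R := R) c.rep
  -- `Nat.card` of an infinite fibre would be 0, so finiteness is checked separately: each L is the
  -- kernel of one of finitely many surjections.
  have hfin : Finite {L // cls L = c} := by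
    have he : ∀ L : {L // cls L = c}, Nonempty (((Fin n → R) ⧸ L.1.1) ≃ₗ[R] c.rep) := fun L =>
      haveI := L.1.2
      ofFinite_eq_iff.mp L.2
    refine Finite.of_injective (β := SurjectiveLinearMap R (Fin n → R) c.rep)
      (fun L => SurjectiveLinearMap.sigmaQuotientEquiv _ _ ⟨⟨L.1.1, he L⟩, (he L).some⟩)
      fun L L' hL => Subtype.ext (Subtype.ext ?_)
    exact congrArg (fun x => x.1.1) ((SurjectiveLinearMap.sigmaQuotientEquiv _ _).injective hL)
  have : Fintype {L // cls L = c} := Fintype.ofFinite _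
  have hconst : ∀ L : {L // cls L = c}, h (cls (Equiv.sigmaFiberEquiv cls ⟨c, L⟩)) = h c :=
    fun L => congrArg h L.2
  rw [tsum_congr hconst, tsum_fintype, Finset.sum_const,
    Finset.card_univ, nsmul_eq_mul, ← Nat.card_eq_fintype_card, hcard, Nat.cast_mul, mul_assoc,
    ENNReal.mul_inv_cancel hpos (ENNReal.natCast_ne_top _), mul_one, mul_comm]

end DVR

end FiniteModuleClass

/-! ### The moments of the weights 1/(|Aut X| |X|) -/

section

variable {R : Type u} [CommRing R]

theorem Submodule.card_quotient_map_subtype {F : Type*} [AddCommGroup F] [Module R F]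
    (K : Submodule R F) (L : Submodule R K) :
    Nat.card (F ⧸ L.map K.subtype) = Nat.card (F ⧸ K) * Nat.card (K ⧸ L) := by
  simp only [← Submodule.cardQuot_apply, Submodule.cardQuot]
  have h : (L.map K.subtype).toAddSubgroup = L.toAddSubgroup.map K.toAddSubgroup.subtype := rfl
  rw [h, AddSubgroup.index_map_subtype, mul_comm]

theorem tsum_finiteIndexSubmodules_le {F : Type*} [AddCommGroup F] [Module R F]
    (K : Submodule R F) [Finite (F ⧸ K)] (s : ℕ) :
    ∑' L : {L : {L : Submodule R F // Finite (F ⧸ L)} // L.1 ≤ K},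
      (Nat.card (F ⧸ L.1.1) : ℝ≥0∞)⁻¹ ^ s = (Nat.card (F ⧸ K) : ℝ≥0∞)⁻¹ ^ s * latticeZeta R K s := by
  have hK : Nat.card (F ⧸ K) ≠ 0 := Nat.card_pos.ne'
  let e : {L : Submodule R K // Finite (K ⧸ L)} ≃
      {L : {L : Submodule R F // Finite (F ⧸ L)} // L.1 ≤ K} :=
    ((Submodule.MapSubtype.orderIso K).toEquiv.subtypeEquiv (q := fun L => Finite (F ⧸ L.1))
      fun L => by
        have h := K.card_quotient_map_subtype L
        constructor
        · intro hL
          refine Nat.finite_of_card_ne_zero (h.trans_ne ?_)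
          exact mul_ne_zero hK Nat.card_pos.ne'
        · intro hL
          have hL' : Finite (F ⧸ L.map K.subtype) := hL
          refine Nat.finite_of_card_ne_zero (right_ne_zero_of_mul (h.symm.trans_ne ?_))
          exact Nat.card_pos.ne').trans
      ⟨fun L => ⟨⟨L.1.1, L.2⟩, L.1.2⟩, fun L => ⟨⟨L.1.1, L.2⟩, L.1.2⟩, fun _ => rfl, fun _ => rfl⟩
  rw [← e.tsum_eq, latticeZeta, ← ENNReal.tsum_mul_left]
  refine tsum_congr fun L => ?_
  have h : Nat.card (F ⧸ (e L).1.1) = Nat.card (F ⧸ K) * Nat.card (K ⧸ L.1) :=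
    K.card_quotient_map_subtype L.1
  rw [h, Nat.cast_mul, ENNReal.mul_inv (Or.inl (by exact_mod_cast hK))
    (Or.inl (ENNReal.natCast_ne_top _)), mul_pow]

theorem Module.exists_ne_zero_smul_eq_zero_of_finite [Infinite R] (M : Type*) [AddCommGroup M]
    [Module R M] [Finite M] : ∃ a : R, a ≠ 0 ∧ ∀ x : M, a • x = 0 := by
  obtain ⟨a, b, hab, h⟩ := Finite.exists_ne_map_eq_of_infinite (fun (a : R) (x : M) => a • x)
  exact ⟨a - b, sub_ne_zero.mpr hab, fun x => by rw [sub_smul, sub_eq_zero]; exact congrFun h x⟩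

/-- Some a ≠ 0 kills the quotient, so aR^n ⊆ K ⊆ R^n, and `K` is free of rank `n` over the principal
ideal domain. -/
theorem Submodule.nonempty_linearEquiv_pi_of_finite_quotient [IsDomain R] [IsPrincipalIdealRing R]
    [Infinite R] {n : ℕ} (K : Submodule R (Fin n → R)) [Finite ((Fin n → R) ⧸ K)] :
    Nonempty (K ≃ₗ[R] (Fin n → R)) := by
  obtain ⟨a, ha, hK⟩ := Module.exists_ne_zero_smul_eq_zero_of_finite (R := R) ((Fin n → R) ⧸ K)
  have hmem : ∀ x : Fin n → R, a • x ∈ K := fun x => by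
    rw [← Submodule.Quotient.mk_eq_zero, Submodule.Quotient.mk_smul, hK]
  let f : (Fin n → R) →ₗ[R] K := LinearMap.codRestrict K (LinearMap.lsmul R (Fin n → R) a) hmem
  have hf : Function.Injective f := by
    intro x y hxy
    exact smul_right_injective _ ha (congrArg Subtype.val hxy)
  refine ⟨LinearEquiv.ofFinrankEq _ _ (le_antisymm ?_ ?_)⟩
  · exact LinearMap.finrank_le_finrank_of_injective K.subtype_injective
  · exact LinearMap.finrank_le_finrank_of_injective hf

namespace FiniteModuleClass

/-- Both sides count pairs L ≤ ker f, with f : R^n → M surjective, weighted by |R^n/L|^(-n-1). For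
fixed f the sum is a zeta function of ker f, which is isomorphic to R^n. -/
theorem tsum_numSur_mul_card_surjective [IsDomain R] [IsPrincipalIdealRing R] [Infinite R] (n : ℕ)
    (M : Type v) [AddCommGroup M] [Module R M] [Finite M] :
    ∑' c : FiniteModuleClass.{u, v} R, ((c.numSur M : ℝ≥0∞) * (Nat.card c.rep : ℝ≥0∞)⁻¹ ^ (n + 1)) *
      (Nat.card (SurjectiveLinearMap R (Fin n → R) c.rep) *
        (Nat.card (c.rep ≃ₗ[R] c.rep) : ℝ≥0∞)⁻¹) =
    Nat.card (SurjectiveLinearMap R (Fin n → R) M) *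
      ((Nat.card M : ℝ≥0∞)⁻¹ ^ (n + 1) * latticeZeta R (Fin n → R) (n + 1)) := by
  rw [← tsum_finiteIndexSubmodules_comp_ofFinite n fun c : FiniteModuleClass.{u, v} R =>
    (c.numSur M : ℝ≥0∞) * (Nat.card c.rep : ℝ≥0∞)⁻¹ ^ (n + 1)]
  let F := Fin n → R
  have hterm : ∀ L : {L : Submodule R F // Finite (F ⧸ L)},
      (haveI := L.2
       (((ofFinite R (F ⧸ L.1) : FiniteModuleClass.{u, v} R).numSur M : ℝ≥0∞) *
        (Nat.card (ofFinite R (F ⧸ L.1) : FiniteModuleClass.{u, v} R).rep : ℝ≥0∞)⁻¹ ^ (n + 1))) =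
      ∑' _ : {f : SurjectiveLinearMap R F M // L.1 ≤ LinearMap.ker f.1},
        (Nat.card (F ⧸ L.1) : ℝ≥0∞)⁻¹ ^ (n + 1) := by
    intro L
    have := L.2
    obtain ⟨e⟩ := ofFinite_eq_iff.mp (rfl : ofFinite R (F ⧸ L.1) = ofFinite.{u, v} R (F ⧸ L.1))
    have : Fintype {f : SurjectiveLinearMap R F M // L.1 ≤ LinearMap.ker f.1} := Fintype.ofFinite _
    rw [tsum_fintype, Finset.sum_const, Finset.card_univ, ← Nat.card_eq_fintype_card, nsmul_eq_mul,
      numSur_eq_of_linearEquiv e, ← Nat.card_congr e.toEquiv,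
      Nat.card_congr (SurjectiveLinearMap.quotientEquiv M L.1)]
  refine (tsum_congr hterm).trans ?_
  let e : (Σ L : {L : Submodule R F // Finite (F ⧸ L)},
        {f : SurjectiveLinearMap R F M // L.1 ≤ LinearMap.ker f.1}) ≃
      (Σ f : SurjectiveLinearMap R F M,
        {L : {L : Submodule R F // Finite (F ⧸ L)} // L.1 ≤ LinearMap.ker f.1}) :=
    ⟨fun x => ⟨x.2.1, x.1, x.2.2⟩, fun x => ⟨x.2.1, x.1, x.2.2⟩, fun _ => rfl, fun _ => rfl⟩
  rw [← ENNReal.tsum_sigma' (fun x : (Σ L : {L : Submodule R F // Finite (F ⧸ L)},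
        {f : SurjectiveLinearMap R F M // L.1 ≤ LinearMap.ker f.1}) =>
          (Nat.card (F ⧸ x.1.1) : ℝ≥0∞)⁻¹ ^ (n + 1)), ← e.symm.tsum_eq, ENNReal.tsum_sigma']
  have hsum : ∀ f : SurjectiveLinearMap R F M,
      ∑' L : {L : {L : Submodule R F // Finite (F ⧸ L)} // L.1 ≤ LinearMap.ker f.1},
        (Nat.card (F ⧸ L.1.1) : ℝ≥0∞)⁻¹ ^ (n + 1) =
      (Nat.card M : ℝ≥0∞)⁻¹ ^ (n + 1) * latticeZeta R F (n + 1) := by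
    intro f
    have eM := f.1.quotKerEquivOfSurjective f.2
    have : Finite (F ⧸ LinearMap.ker f.1) := eM.toEquiv.finite_iff.mpr inferInstance
    obtain ⟨g⟩ := (LinearMap.ker f.1).nonempty_linearEquiv_pi_of_finite_quotient
    rw [tsum_finiteIndexSubmodules_le, Nat.card_congr eM.toEquiv, latticeZeta_congr g]
  have : Fintype (SurjectiveLinearMap R F M) := Fintype.ofFinite _
  refine (tsum_congr hsum).trans ?_
  rw [tsum_fintype, Finset.sum_const, Finset.card_univ, ← Nat.card_eq_fintype_card, nsmul_eq_mul]

end FiniteModuleClass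

theorem ENNReal.tsum_iSup_of_monotone {α : Type*} {f : α → ℕ → ℝ≥0∞} (hf : ∀ a, Monotone (f a)) :
    ∑' a, ⨆ n, f a n = ⨆ n, ∑' a, f a n := by
  simp_rw [ENNReal.tsum_eq_iSup_sum]
  rw [iSup_comm]
  exact iSup_congr fun s => ENNReal.finsetSum_iSup_of_monotone hf

variable (R) in
/-- The partial products `∏_{i < n} (1 - q ^ (-i - 2))⁻¹`, where `q` is the cardinality of the
residue field. -/
noncomputable def eulerProduct [IsLocalRing R] (n : ℕ) : ℝ≥0∞ :=
  ∏ i ∈ Finset.range n, (1 - (Nat.card (IsLocalRing.ResidueField R) : ℝ≥0∞)⁻¹ ^ (i + 2))⁻¹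

variable [IsDomain R] [IsDiscreteValuationRing R] [Finite (IsLocalRing.ResidueField R)]

theorem FiniteModuleClass.tsum_numSur_div_autMulCard (M : Type v) [AddCommGroup M] [Module R M]
    [Finite M] {Z : ℝ≥0∞} (hZ : Filter.Tendsto (eulerProduct R) Filter.atTop (nhds Z)) :
    ∑' c : FiniteModuleClass.{u, v} R, (c.numSur M : ℝ≥0∞) * c.autMulCard⁻¹ =
      (Nat.card M : ℝ≥0∞)⁻¹ * Z := by
  have := IsDiscreteValuationRing.infinite (R := R)
  -- The generating probability increases to 1, so monotone convergence passes from the identity for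
  -- R^n to the limit.
  let t : FiniteModuleClass.{u, v} R → ℕ → ℝ≥0∞ := fun c n =>
    (c.numSur M : ℝ≥0∞) * c.autMulCard⁻¹ * SurjectiveLinearMap.generatingProbability R c.rep n
  have hmono : ∀ c, Monotone (t c) := fun c m n hmn =>
    mul_le_mul_right (SurjectiveLinearMap.generatingProbability_mono c.rep hmn) _
  have hsup : ∀ c, ⨆ n, t c n = (c.numSur M : ℝ≥0∞) * c.autMulCard⁻¹ := by
    intro c
    refine tendsto_nhds_unique (tendsto_atTop_iSup (hmono c)) ?_
    have h := ENNReal.Tendsto.const_mul (a := (c.numSur M : ℝ≥0∞) * c.autMulCard⁻¹)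
      (SurjectiveLinearMap.tendsto_generatingProbability (R := R) c.rep) (Or.inl one_ne_zero)
    rwa [mul_one] at h
  have hsum : ∀ n, ∑' c, t c n = (Nat.card M : ℝ≥0∞)⁻¹ *
      (SurjectiveLinearMap.generatingProbability R M n * eulerProduct R n) := by
    intro n
    have h := tsum_numSur_mul_card_surjective (R := R) n M
    rw [latticeZeta_pi] at h
    refine Eq.trans (tsum_congr fun c => ?_) (h.trans ?_)
    · simp only [t, SurjectiveLinearMap.generatingProbability, autMulCard]
      rw [ENNReal.mul_inv (Or.inl (natCard_linearEquiv_ne_zero _))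
        (Or.inl (ENNReal.natCast_ne_top _))]
      ring
    · simp only [SurjectiveLinearMap.generatingProbability, eulerProduct]
      ring
  refine tendsto_nhds_unique (f := fun n => ∑' c, t c n) (l := Filter.atTop) ?_ ?_
  · rw [← tsum_congr hsup, ENNReal.tsum_iSup_of_monotone hmono]
    exact tendsto_atTop_iSup fun m n hmn => ENNReal.tsum_le_tsum fun c => hmono c hmn
  · simp_rw [hsum]
    have h := ENNReal.Tendsto.mul
      (SurjectiveLinearMap.tendsto_generatingProbability (R := R) M) (Or.inl one_ne_zero) hZ
      (Or.inr ENNReal.one_ne_top)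
    rw [one_mul] at h
    exact ENNReal.Tendsto.const_mul h
      (Or.inr (ENNReal.inv_ne_top.mpr (SurjectiveLinearMap.natCard_ne_zero M)))

end

/-! ### Bounds for the infinite product -/

section EulerProduct

/-- Uniqueness needs a lower bound above 1/2. The worst case is x = 1/2. -/
theorem nine_div_sixteen_le_prod_one_sub_pow {x : ℝ} (hx0 : 0 ≤ x) (hx : x ≤ 1 / 2) (n : ℕ) :
    9 / 16 ≤ ∏ i ∈ Finset.range n, (1 - x ^ (i + 2)) := by
  -- The decaying term makes the induction close; there is equality at n = 0, where both sides are
  -- 3/4.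
  have h1 : ∀ n : ℕ, 9 / 16 + 3 / 16 * (1 / 2 : ℝ) ^ n ≤
      ∏ i ∈ Finset.range (n + 1), (1 - (1 / 2 : ℝ) ^ (i + 2)) := by
    intro n
    induction n with
    | zero => norm_num
    | succ n ih =>
      rw [Finset.prod_range_succ]
      have h0 : (0 : ℝ) ≤ (1 / 2 : ℝ) ^ n := by positivity
      have hle : (1 / 2 : ℝ) ^ n ≤ 1 := pow_le_one₀ (by norm_num) (by norm_num)
      have h2 : (0 : ℝ) ≤ 1 - (1 / 2) ^ (n + 1 + 2) :=
        sub_nonneg.mpr (pow_le_one₀ (by norm_num) (by norm_num))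
      refine le_trans ?_ (mul_le_mul_of_nonneg_right ih h2)
      rw [show n + 1 + 2 = n + 3 by ring, pow_add _ n 3, pow_succ]
      nlinarith
  have h2 : 9 / 16 ≤ ∏ i ∈ Finset.range n, (1 - (1 / 2 : ℝ) ^ (i + 2)) := by
    rcases n with _ | n
    · norm_num
    · exact le_trans (le_add_of_nonneg_right (by positivity)) (h1 n)
  refine h2.trans (Finset.prod_le_prod (fun i _ => ?_) fun i _ => ?_)
  · exact sub_nonneg.mpr (pow_le_one₀ (by norm_num) (by norm_num))
  · exact sub_le_sub_left (pow_le_pow_left₀ hx0 hx _) _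

theorem multipliable_one_sub_pow_add_two {x : ℝ} (hx0 : 0 ≤ x) (hx : x ≤ 1 / 2) :
    Multipliable fun i : ℕ => 1 - x ^ (i + 2) := by
  simp_rw [sub_eq_add_neg]
  refine multipliable_one_add_of_summable ?_
  have := (summable_nat_add_iff 2).mpr
    (summable_geometric_of_lt_one hx0 (lt_of_le_of_lt hx (by norm_num)))
  simpa [abs_of_nonneg, hx0] using this

theorem nine_div_sixteen_le_tprod_one_sub_pow {x : ℝ} (hx0 : 0 ≤ x) (hx : x ≤ 1 / 2) :
    9 / 16 ≤ ∏' i : ℕ, (1 - x ^ (i + 2)) :=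
  ge_of_tendsto' (multipliable_one_sub_pow_add_two hx0 hx).hasProd.tendsto_prod_nat
    (nine_div_sixteen_le_prod_one_sub_pow hx0 hx)

theorem tprod_one_sub_pow_le_one {x : ℝ} (hx0 : 0 ≤ x) (hx : x ≤ 1 / 2) :
    ∏' i : ℕ, (1 - x ^ (i + 2)) ≤ 1 :=
  le_of_tendsto' (multipliable_one_sub_pow_add_two hx0 hx).hasProd.tendsto_prod_nat fun _ =>
    Finset.prod_le_one (fun _ _ => sub_nonneg.mpr (pow_le_one₀ hx0 (hx.trans (by norm_num))))
      fun _ _ => sub_le_self _ (pow_nonneg hx0 _)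

variable (R : Type u) [CommRing R] [IsLocalRing R] [Finite (IsLocalRing.ResidueField R)]

theorem IsLocalRing.inv_card_residueField_le :
    ((Nat.card (IsLocalRing.ResidueField R) : ℝ))⁻¹ ≤ 1 / 2 := by
  rw [one_div]
  exact inv_anti₀ (by norm_num) (by exact_mod_cast Finite.one_lt_card)

theorem eulerProduct_eq (n : ℕ) : eulerProduct R n = (ENNReal.ofReal (∏ i ∈ Finset.range n,
    (1 - ((Nat.card (IsLocalRing.ResidueField R) : ℝ))⁻¹ ^ (i + 2))))⁻¹ := by
  have hq := IsLocalRing.inv_card_residueField_le R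
  have hq1 : (0 : ℝ) < Nat.card (IsLocalRing.ResidueField R) := by exact_mod_cast Nat.card_pos
  have hpos : ∀ i : ℕ, 0 < 1 - ((Nat.card (IsLocalRing.ResidueField R) : ℝ))⁻¹ ^ (i + 2) := by
    intro i
    refine sub_pos.mpr (pow_lt_one₀ (by positivity) (lt_of_le_of_lt hq (by norm_num)) (by omega))
  induction n with
  | zero => simp [eulerProduct]
  | succ n ih =>
    rw [eulerProduct, Finset.prod_range_succ, ← eulerProduct, ih, Finset.prod_range_succ,
      ENNReal.ofReal_mul (Finset.prod_nonneg fun i _ => (hpos i).le),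
      ENNReal.mul_inv (Or.inr ENNReal.ofReal_ne_top) (Or.inr (ENNReal.ofReal_pos.mpr (hpos n)).ne'),
      ENNReal.ofReal_sub _ (by positivity), ENNReal.ofReal_one,
      ENNReal.ofReal_pow (by positivity), ENNReal.ofReal_inv_of_pos hq1, ENNReal.ofReal_natCast]

theorem tendsto_eulerProduct : Filter.Tendsto (eulerProduct R) Filter.atTop
    (nhds (ENNReal.ofReal (∏' i : ℕ,
      (1 - ((Nat.card (IsLocalRing.ResidueField R) : ℝ))⁻¹ ^ (i + 2))))⁻¹) := by
  rw [show eulerProduct R = _ from funext (eulerProduct_eq R)]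
  exact tendsto_inv_iff.mpr (ENNReal.tendsto_ofReal (multipliable_one_sub_pow_add_two
    (by positivity) (IsLocalRing.inv_card_residueField_le R)).hasProd.tendsto_prod_nat)

end EulerProduct

/-! ### Countability and discreteness of the set of classes -/

namespace FiniteModuleClass

variable {R : Type u} [CommRing R]

instance [IsDomain R] [IsDiscreteValuationRing R] [Finite (IsLocalRing.ResidueField R)] :
    Countable (FiniteModuleClass.{u, v} R) := by
  have := countable_finiteIndexSubmodules_pi (R := R)
  let f : (Σ n : ℕ, {L : Submodule R (Fin n → R) // Finite ((Fin n → R) ⧸ L)}) →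
      FiniteModuleClass.{u, v} R := fun x => haveI := x.2.2; ofFinite R ((Fin x.1 → R) ⧸ x.2.1)
  refine Function.Surjective.countable (f := f) fun c => ?_
  obtain ⟨n, g, hg⟩ := Module.Finite.exists_fin' R c.rep
  have e := g.quotKerEquivOfSurjective hg
  have : Finite ((Fin n → R) ⧸ LinearMap.ker g) := e.toEquiv.finite_iff.mpr inferInstance
  exact ⟨⟨n, LinearMap.ker g, this⟩, ofFinite_eq_iff.mpr ⟨e⟩⟩

theorem nonempty_tensor_quotient_linearEquiv {X : Type*} [AddCommGroup X] [Module R X] {I : Ideal R}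
    (h : I • (⊤ : Submodule R X) = ⊥) : Nonempty ((X ⊗[R] (R ⧸ I)) ≃ₗ[R] X) :=
  ⟨(TensorProduct.tensorQuotEquivQuotSMul X I).trans (Submodule.quotEquivOfEqBot _ h)⟩

theorem span_smul_top_eq_bot_iff {X : Type*} [AddCommGroup X] [Module R X] {a : R} :
    Ideal.span {a} • (⊤ : Submodule R X) = ⊥ ↔ ∀ x : X, a • x = 0 := by
  rw [eq_bot_iff, Submodule.ideal_span_singleton_smul]
  constructor
  · intro h x
    exact h (Submodule.smul_mem_pointwise_smul x a ⊤ trivial)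
  · rintro h _ ⟨x, -, rfl⟩
    exact h x

/-- Since X/abX ≅ M is killed by a, aX ⊆ b(aX), and Nakayama gives aX = 0. -/
theorem smul_eq_zero_of_linearEquiv_tensor [IsLocalRing R] {X M : Type*} [AddCommGroup X]
    [Module R X] [Finite X] [AddCommGroup M] [Module R M] {a b : R} (hM : ∀ x : M, a • x = 0)
    (hb : b ∈ IsLocalRing.maximalIdeal R) (e : (X ⊗[R] (R ⧸ Ideal.span {a * b})) ≃ₗ[R] M) (x : X) :
    a • x = 0 := by
  let e' := (TensorProduct.tensorQuotEquivQuotSMul X (Ideal.span {a * b})).symm.trans e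
  let N : Submodule R X := LinearMap.range (LinearMap.lsmul R X a)
  have hN : N ≤ Ideal.span {b} • N := by
    rintro _ ⟨y, rfl⟩
    have h1 : a • y ∈ Ideal.span {a * b} • (⊤ : Submodule R X) := by
      rw [← Submodule.Quotient.mk_eq_zero, Submodule.Quotient.mk_smul]
      exact e'.injective (by rw [map_smul, hM, map_zero])
    rw [Submodule.ideal_span_singleton_smul] at h1
    obtain ⟨z, -, hz⟩ := h1
    change a • y ∈ _
    rw [← hz]
    change (a * b) • z ∈ _
    rw [mul_comm, mul_smul]
    exact Submodule.smul_mem_smul (Ideal.mem_span_singleton_self b) ⟨z, rfl⟩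
  have hbot : N = ⊥ := Submodule.eq_bot_of_le_smul_of_le_jacobson_bot (Ideal.span {b}) N
    (IsNoetherian.noetherian N) hN
    (((Ideal.span_singleton_le_iff_mem _).mpr hb).trans (IsLocalRing.maximalIdeal_le_jacobson _))
  exact (Submodule.eq_bot_iff N).mp hbot _ ⟨x, rfl⟩

/-- If a ≠ 0 kills c, the basic open set of c and I = (aπ) is {c}: X ⊗ R/I ≅ c forces aX = 0, and
then X ⊗ R/I ≅ X. The extra factor π is what Nakayama requires. -/
theorem isOpen_singleton_of_isDiscreteValuationRing [IsDomain R] [IsDiscreteValuationRing R]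
    (c : FiniteModuleClass.{u, v} R) : IsOpen ({c} : Set (FiniteModuleClass.{u, v} R)) := by
  have := IsDiscreteValuationRing.infinite (R := R)
  obtain ⟨a, ha, hM⟩ := Module.exists_ne_zero_smul_eq_zero_of_finite (R := R) c.rep
  obtain ⟨π, hπ⟩ := IsDiscreteValuationRing.exists_irreducible R
  have hπm : π ∈ IsLocalRing.maximalIdeal R := hπ.not_isUnit
  have hkill : ∀ {X : Type v} [AddCommGroup X] [Module R X], (∀ x : X, a • x = 0) →
      Nonempty ((X ⊗[R] (R ⧸ Ideal.span {a * π})) ≃ₗ[R] X) := fun {X} _ _ hX =>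
    nonempty_tensor_quotient_linearEquiv (span_smul_top_eq_bot_iff.mpr fun x => by
      rw [mul_comm, mul_smul, hX, smul_zero])
  refine TopologicalSpace.isOpen_generateFrom_of_mem
    ⟨⟨ModuleCat.of R c.rep, inferInstanceAs (Finite c.rep)⟩, Ideal.span {a * π}, ?_, ?_⟩
  · rw [Ne, Ideal.span_singleton_eq_bot]
    exact mul_ne_zero ha hπ.ne_zero
  · ext c'
    rw [Set.mem_singleton_iff]
    constructor
    · rintro rfl
      exact ⟨Quotient.out c', Quotient.out_eq c', hkill hM⟩
    · rintro ⟨X, rfl, ⟨e⟩⟩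
      have := X.2
      obtain ⟨e'⟩ := hkill (smul_eq_zero_of_linearEquiv_tensor hM hπm e)
      rw [← mk_rep c]
      exact Quotient.sound ⟨e'.symm.trans e⟩

instance [IsDomain R] [IsDiscreteValuationRing R] :
    MeasurableSingletonClass (FiniteModuleClass.{u, v} R) :=
  ⟨fun c => (isOpen_singleton_of_isDiscreteValuationRing c).measurableSet⟩

/-! ### Uniqueness by contraction -/

section Uniqueness

variable {z : ℝ≥0∞}

/-- In the moment equation at c, the term d = c has coefficient |Aut c|, and by `hz` the other terms
of w sum to z/|c|. As x and y have equal moments, an excess of x over y of at most εw off the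
diagonal allows y an excess of at most εz/(|Aut c| |c|) at c. -/
theorem le_add_mul_of_forall_le_add_mul {x y : FiniteModuleClass.{u, v} R → ℝ≥0∞}
    (hz : ∀ c : FiniteModuleClass.{u, v} R,
      ∑' d : FiniteModuleClass.{u, v} R, (d.numSur c.rep : ℝ≥0∞) * d.autMulCard⁻¹ =
        (Nat.card c.rep : ℝ≥0∞)⁻¹ * (1 + z))
    (hx : ∀ c : FiniteModuleClass.{u, v} R,
      ∑' d : FiniteModuleClass.{u, v} R, (d.numSur c.rep : ℝ≥0∞) * x d =
        (Nat.card c.rep : ℝ≥0∞)⁻¹)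
    (hy : ∀ c : FiniteModuleClass.{u, v} R,
      ∑' d : FiniteModuleClass.{u, v} R, (d.numSur c.rep : ℝ≥0∞) * y d =
        (Nat.card c.rep : ℝ≥0∞)⁻¹)
    {ε : ℝ≥0∞} (hxy : ∀ c, x c ≤ y c + ε * c.autMulCard⁻¹) (c : FiniteModuleClass.{u, v} R) :
    y c ≤ x c + ε * z * c.autMulCard⁻¹ := by
  classical
  have hc0 := SurjectiveLinearMap.natCard_ne_zero c.rep
  have hA0 := natCard_linearEquiv_ne_zero (R := R) c.rep
  have hAt : (Nat.card (c.rep ≃ₗ[R] c.rep) : ℝ≥0∞) ≠ ⊤ := ENNReal.natCast_ne_top _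
  have hct : (Nat.card c.rep : ℝ≥0∞)⁻¹ ≠ ⊤ := ENNReal.inv_ne_top.mpr hc0
  set A : ℝ≥0∞ := (Nat.card (c.rep ≃ₗ[R] c.rep) : ℝ≥0∞)
  set N : ℝ≥0∞ := (Nat.card c.rep : ℝ≥0∞)⁻¹
  have hw : c.autMulCard⁻¹ = A⁻¹ * N := ENNReal.mul_inv (Or.inl hA0) (Or.inl hAt)
  let T : (FiniteModuleClass.{u, v} R → ℝ≥0∞) → ℝ≥0∞ := fun f =>
    ∑' d : FiniteModuleClass.{u, v} R, if d = c then 0 else (d.numSur c.rep : ℝ≥0∞) * f d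
  have hsplit : ∀ f : FiniteModuleClass.{u, v} R → ℝ≥0∞,
      ∑' d : FiniteModuleClass.{u, v} R, (d.numSur c.rep : ℝ≥0∞) * f d = A * f c + T f := by
    intro f
    rw [ENNReal.tsum_eq_add_tsum_ite c, numSur_self]
  have hzc := hz c
  have hxc := hx c
  have hyc := hy c
  rw [hsplit] at hzc hxc hyc
  have hT : T (fun d => d.autMulCard⁻¹) = N * z := by
    rw [hw, ← mul_assoc, ENNReal.mul_inv_cancel hA0 hAt, one_mul, mul_add, mul_one] at hzc
    exact (ENNReal.add_right_inj hct).mp hzc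
  have hTxy : T x ≤ T y + ε * (N * z) := by
    rw [← hT, ← ENNReal.tsum_mul_left, ← ENNReal.tsum_add]
    refine ENNReal.tsum_le_tsum fun d => ?_
    split_ifs with h
    · exact zero_le
    · calc _ ≤ (d.numSur c.rep : ℝ≥0∞) * (y d + ε * d.autMulCard⁻¹) := mul_le_mul_right (hxy d) _
        _ = _ := by ring
  -- Finiteness permits cancelling `T y` in `ℝ≥0∞`.
  have hTy : T y ≠ ⊤ := ne_top_of_le_ne_top hct (le_add_self.trans hyc.le)
  have hle : A * y c ≤ A * x c + ε * (N * z) := by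
    rw [← ENNReal.add_le_add_iff_right hTy, hyc, ← hxc, add_assoc, add_comm (ε * (N * z))]
    exact add_le_add_right hTxy _
  calc y c = A⁻¹ * (A * y c) := by
        rw [← mul_assoc, ENNReal.inv_mul_cancel hA0 hAt, one_mul]
    _ ≤ A⁻¹ * (A * x c + ε * (N * z)) := mul_le_mul_right hle _
    _ = A⁻¹ * A * x c + ε * z * (A⁻¹ * N) := by ring
    _ = _ := by rw [ENNReal.inv_mul_cancel hA0 hAt, one_mul, hw]

/-- The diagonal term alone bounds each solution by w, so the comparison starts at ε = 1; each round
multiplies ε by z < 1. -/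
theorem eq_of_tsum_numSur_eq {x y : FiniteModuleClass.{u, v} R → ℝ≥0∞} (hz1 : z < 1)
    (hz : ∀ c : FiniteModuleClass.{u, v} R,
      ∑' d : FiniteModuleClass.{u, v} R, (d.numSur c.rep : ℝ≥0∞) * d.autMulCard⁻¹ =
        (Nat.card c.rep : ℝ≥0∞)⁻¹ * (1 + z))
    (hx : ∀ c : FiniteModuleClass.{u, v} R,
      ∑' d : FiniteModuleClass.{u, v} R, (d.numSur c.rep : ℝ≥0∞) * x d =
        (Nat.card c.rep : ℝ≥0∞)⁻¹)
    (hy : ∀ c : FiniteModuleClass.{u, v} R,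
      ∑' d : FiniteModuleClass.{u, v} R, (d.numSur c.rep : ℝ≥0∞) * y d =
        (Nat.card c.rep : ℝ≥0∞)⁻¹) : x = y := by
  have hbound : ∀ {f : FiniteModuleClass.{u, v} R → ℝ≥0∞},
      (∀ c : FiniteModuleClass.{u, v} R,
        ∑' d : FiniteModuleClass.{u, v} R, (d.numSur c.rep : ℝ≥0∞) * f d =
          (Nat.card c.rep : ℝ≥0∞)⁻¹) → ∀ c, f c ≤ c.autMulCard⁻¹ := by
    intro f hf c
    have h := ENNReal.le_tsum (f := fun d : FiniteModuleClass.{u, v} R =>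
      (d.numSur c.rep : ℝ≥0∞) * f d) c
    rw [hf, numSur_self] at h
    rw [autMulCard, ENNReal.mul_inv (Or.inl (natCard_linearEquiv_ne_zero _))
      (Or.inl (ENNReal.natCast_ne_top _)), mul_comm, ← div_eq_mul_inv]
    exact (ENNReal.le_div_iff_mul_le (Or.inl (natCard_linearEquiv_ne_zero _))
      (Or.inl (ENNReal.natCast_ne_top _))).mpr (by rwa [mul_comm])
  have key : ∀ k : ℕ, (∀ c, x c ≤ y c + z ^ k * c.autMulCard⁻¹) ∧
      ∀ c, y c ≤ x c + z ^ k * c.autMulCard⁻¹ := by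
    intro k
    induction k with
    | zero =>
      simp only [pow_zero, one_mul]
      exact ⟨fun c => (hbound hx c).trans le_add_self, fun c => (hbound hy c).trans le_add_self⟩
    | succ k ih =>
      simp only [pow_succ]
      exact ⟨le_add_mul_of_forall_le_add_mul hz hy hx ih.2,
        le_add_mul_of_forall_le_add_mul hz hx hy ih.1⟩
  have hlim : ∀ (a : ℝ≥0∞) (c : FiniteModuleClass.{u, v} R), Filter.Tendsto
      (fun k : ℕ => a + z ^ k * c.autMulCard⁻¹) Filter.atTop (nhds a) := by
    intro a c
    have h := ENNReal.Tendsto.mul_const (b := c.autMulCard⁻¹)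
      (ENNReal.tendsto_pow_atTop_nhds_zero_of_lt_one hz1)
      (Or.inr (ENNReal.inv_ne_top.mpr c.autMulCard_ne_zero))
    simpa using (tendsto_const_nhds (x := a)).add h
  funext c
  exact le_antisymm (ge_of_tendsto' (hlim _ c) fun k => (key k).1 c)
    (ge_of_tendsto' (hlim _ c) fun k => (key k).2 c)

end Uniqueness

theorem numSur_of_subsingleton (c : FiniteModuleClass.{u, v} R) (M : Type v) [AddCommGroup M]
    [Module R M] [Subsingleton M] : c.numSur M = 1 := by
  rw [numSur_eq_of_linearEquiv (LinearEquiv.refl R _), Nat.card_eq_one_iff_unique]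
  exact ⟨⟨fun f g => Subtype.ext (LinearMap.ext fun x => Subsingleton.elim _ _)⟩,
    ⟨0, fun y => ⟨0, Subsingleton.elim _ _⟩⟩⟩

end FiniteModuleClass

/-! ### The measure over a discrete valuation ring, and the theorem -/

open MeasureTheory FiniteModuleClass in
theorem IsDiscreteValuationRing.exists_unique_measure_hasInverseCardMoments (R : Type u)
    [CommRing R] [IsDomain R] [IsDiscreteValuationRing R] [Finite (IsLocalRing.ResidueField R)] :
    ∃ μ : ProbabilityMeasure (FiniteModuleClass.{u, v} R),
      HasInverseCardMoments R (μ : Measure _) ∧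
      (∀ ν : ProbabilityMeasure (FiniteModuleClass.{u, v} R),
        HasInverseCardMoments R (ν : Measure _) → ν = μ) ∧
      ∀ (M : Type v) [AddCommGroup M] [Module R M] [Finite M],
        (μ : Measure (FiniteModuleClass.{u, v} R)).real {FiniteModuleClass.mk R M} =
          1 / ((Nat.card (M ≃ₗ[R] M) : ℝ) * (Nat.card M : ℝ)) *
            ∏' i : ℕ, (1 - ((Nat.card (IsLocalRing.ResidueField R) : ℝ)⁻¹) ^ (i + 2)) := by
  have hx0 : (0 : ℝ) ≤ (Nat.card (IsLocalRing.ResidueField R) : ℝ)⁻¹ := by positivity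
  have hP := nine_div_sixteen_le_tprod_one_sub_pow hx0 (IsLocalRing.inv_card_residueField_le R)
  have hP1 := tprod_one_sub_pow_le_one hx0 (IsLocalRing.inv_card_residueField_le R)
  have hlim := tendsto_eulerProduct R
  set P : ℝ := ∏' i : ℕ, (1 - ((Nat.card (IsLocalRing.ResidueField R) : ℝ)⁻¹) ^ (i + 2))
  have hP0 : ENNReal.ofReal P ≠ 0 := (ENNReal.ofReal_pos.mpr (by linarith)).ne'
  have hsum := fun (M : Type v) [AddCommGroup M] [Module R M] [Finite M] =>
    tsum_numSur_div_autMulCard (R := R) M hlim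
  let w : FiniteModuleClass.{u, v} R → ℝ≥0∞ := fun c => ENNReal.ofReal P * c.autMulCard⁻¹
  have hmoment : ∀ (M : Type v) [AddCommGroup M] [Module R M] [Finite M],
      ∑' c : FiniteModuleClass.{u, v} R, (c.numSur M : ℝ≥0∞) * w c = (Nat.card M : ℝ≥0∞)⁻¹ := by
    intro M _ _ _
    simp_rw [w, mul_left_comm _ (ENNReal.ofReal P), ENNReal.tsum_mul_left, hsum M]
    rw [mul_left_comm, ENNReal.mul_inv_cancel hP0 ENNReal.ofReal_ne_top, mul_one]
  have htotal : HasSum w 1 := by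
    rw [ENNReal.summable.hasSum_iff]
    -- The moment of the zero module is the total mass.
    have h := hmoment PUnit
    simpa only [numSur_of_subsingleton, Nat.cast_one, one_mul, Nat.card_unique, inv_one] using h
  let pmf : PMF (FiniteModuleClass.{u, v} R) := ⟨w, htotal⟩
  have hpmf : ∀ c, pmf.toMeasure {c} = w c := fun c =>
    pmf.toMeasure_apply_singleton c (measurableSet_singleton c)
  have hlintegral : ∀ (ν : Measure (FiniteModuleClass.{u, v} R)) (M : Type v) [AddCommGroup M]
      [Module R M], ∫⁻ X, (X.numSur M : ℝ≥0∞) ∂ν =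
        ∑' c : FiniteModuleClass.{u, v} R, (c.numSur M : ℝ≥0∞) * ν {c} :=
    fun ν M _ _ => lintegral_countable' _
  refine ⟨⟨pmf.toMeasure, inferInstance⟩, ?_, ?_, ?_⟩
  · intro M _ _ _
    rw [ProbabilityMeasure.coe_mk, hlintegral]
    simp_rw [hpmf]
    exact hmoment M
  · intro ν hν
    -- 9/16 ≤ P ≤ 1 gives 1 ≤ 1/P < 2.
    have hz : ∃ z < 1, (ENNReal.ofReal P)⁻¹ = 1 + z := by
      have hinv : P⁻¹ < 2 := by
        rw [inv_lt_comm₀ (by linarith) (by norm_num)]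
        linarith
      refine ⟨ENNReal.ofReal (P⁻¹ - 1), ?_, ?_⟩
      · rw [← ENNReal.ofReal_one]
        exact (ENNReal.ofReal_lt_ofReal_iff one_pos).mpr (by linarith)
      · rw [← ENNReal.ofReal_one, ← ENNReal.ofReal_add zero_le_one
          (sub_nonneg.mpr (one_le_inv_iff₀.mpr ⟨by linarith, hP1⟩)), add_sub_cancel,
          ENNReal.ofReal_inv_of_pos (by linarith)]
    obtain ⟨z, hz1, hz⟩ := hz
    have heq : (fun c => (ν : Measure (FiniteModuleClass.{u, v} R)) {c}) = w :=
      eq_of_tsum_numSur_eq hz1 (fun c => by rw [hsum c.rep, hz])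
        (fun c => by rw [← hlintegral]; exact hν c.rep) fun c => hmoment c.rep
    refine Subtype.ext (Measure.ext_of_singleton fun c => ?_)
    exact (congrFun heq c).trans (hpmf c).symm
  · intro M _ _ _
    rw [ProbabilityMeasure.coe_mk, Measure.real, hpmf]
    simp only [w]
    rw [autMulCard_mk, ENNReal.toReal_mul, ENNReal.toReal_ofReal (by linarith), ENNReal.toReal_inv,
      ENNReal.toReal_mul, ENNReal.toReal_natCast, ENNReal.toReal_natCast, one_div, mul_comm]

theorem proposition11p1 (p : ℕ) [Fact p.Prime] {Γ : Type u} [CommGroup Γ] [Finite Γ]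
    (e : MonoidAlgebra ℚ_[p] Γ) (he : IsPrimitiveIdempotent e) :
    ∃ _ : IsLocalRing (idempotentSubring p he.idem),
      Finite (IsLocalRing.ResidueField (idempotentSubring p he.idem)) ∧
      Multipliable (fun i : ℕ =>
        1 - ((Nat.card (IsLocalRing.ResidueField (idempotentSubring p he.idem)) : ℝ)⁻¹) ^ (i + 2)) ∧
      ∃ μ : MeasureTheory.ProbabilityMeasure
          (FiniteModuleClass.{u, v} (idempotentSubring p he.idem)),
        HasInverseCardMoments (idempotentSubring p he.idem) (μ : MeasureTheory.Measure _) ∧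
        (∀ ν : MeasureTheory.ProbabilityMeasure
            (FiniteModuleClass.{u, v} (idempotentSubring p he.idem)),
          HasInverseCardMoments (idempotentSubring p he.idem) (ν : MeasureTheory.Measure _) → ν = μ) ∧
        ∀ (M : Type v) [AddCommGroup M] [Module (idempotentSubring p he.idem) M] [Finite M],
          (μ : MeasureTheory.Measure (FiniteModuleClass.{u, v} (idempotentSubring p he.idem))).real
              {FiniteModuleClass.mk (idempotentSubring p he.idem) M} =
            1 / ((Nat.card (M ≃ₗ[idempotentSubring p he.idem] M) : ℝ) * (Nat.card M : ℝ)) *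
              ∏' i : ℕ, (1 - ((Nat.card
                (IsLocalRing.ResidueField (idempotentSubring p he.idem)) : ℝ)⁻¹) ^ (i + 2)) := by
  obtain ⟨hdom, hloc, hdvr, hfin⟩ := he.isDiscreteValuationRing_idempotentSubring p
  exact ⟨hloc, hfin, multipliable_one_sub_pow_add_two (by positivity)
    (IsLocalRing.inv_card_residueField_le _),
    IsDiscreteValuationRing.exists_unique_measure_hasInverseCardMoments _⟩
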